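/- **Conventions.** Process expressions are generated from a countably infinite set of constants by $E ::= X \mid \varepsilon \mid E.E \mid E\|E$ and are considered modulo the least congruence for which "$.$" and "$\|$" are associative, "$\|$" is commutative, and $\varepsilon$ is a unit for both. A process rewrite system (PRS) $\Delta$ is a finite set of rules $E \xrightarrow{a} F$. Its transition relation is the least one that contains the rules and satisfies: if $E \xrightarrow{a} F$ then $E.G \xrightarrow{a} F.G$ and $E\|G \xrightarrow{a} F\|G$. A *PA system* is a PRS whose left-hand sides are single constants; a PA process is an expression all of whose constants occur in the rules. An *FS system* is a PRS all of whose left- and right-hand sides are single constants; an FS process is a constant that occurs in the rules. $s \sqsubseteq_{\mathrm{sm}} t$ means that some simulation contains $(s,t)$, where a relation $R$ is a simulation if $(s,t)\in R$ and $s \xrightarrow{a} s'$ imply $t \xrightarrow{a} t'$ for some $t'$ with $(s',t')\in R$. A process is *deterministic* if each process reachable from it has at most one $a$-successor for every action $a$. **Theorem.** (1) The problem $\mathbf{PA} \sqsubseteq_{\mathrm{sm}} \mathbf{FS}$ is undecidable: no algorithm decides, given a PA process $s$ and an FS process $t$ (with their systems), whether $s \sqsubseteq_{\mathrm{sm}}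 t$. (2) Let $\Delta_0$ be the PA system with the rules, for $j=1,2$, $$Z_j \xrightarrow{z_j} Z_j,\quad Z_j \xrightarrow{i_j} C_j.Z_j,\quad C_j \xrightarrow{i_j} C_j.C_j,\quad C_j \xrightarrow{d_j} \varepsilon .$$ Then $Z_1\|Z_2$ is a deterministic PA process. Let $\mathcal M$ be a counter machine with two counters, i.e. a sequence of instructions numbered $1,\dots,n$ with $n \ge 2$, where instruction $n$ is `halt` and each instruction $i<n$ has one of the forms "$c_j:=c_j+1$; goto $k$" and "if $c_j=0$ then goto $k$ else ($c_j:=c_j-1$; goto $l$)" with $j\in\{1,2\}$ and $1\le k,l\le n$. Let $\Delta_{\mathcal M}$ be the FS system with constants $f_1,\dots,f_n,u$ and the following rules: - $f_i \xrightarrow{i_j} f_k$ for each instruction $i$ of the first form, and $f_i \xrightarrow{z_j} f_k$, $f_i \xrightarrow{d_j} f_l$ for each instruction $i$ of the second form; - $u \xrightarrow{a} u$ for each of the six actions $a \in\{i_1,i_2,d_1,d_2,z_1,z_2\}$; - (enforcing the former) $f_i \xrightarrow{a} u$ for each $i<n$ and each of the six actions $a$ for which the first item gives no rule $f_i \xrightarrow{a}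 f_k$. The system $\Delta_{\mathcal M}$ is computable from $\mathcal M$, $f_1$ is a deterministic FS process of it, and $Z_1\|Z_2 \sqsubseteq_{\mathrm{sm}} f_1$ if and only if $\mathcal M$, started at instruction $1$ with both counters equal to zero, does not halt (never reaches instruction $n$). -/

import Mathlib

/-! Proc rewrite systems, simulation preorder, and counter machines. -/

namespace ProcRewrite

/-! ### Transition systems -/

/-- A transition system with action labels in `ℕ` (a countably infinite supply of actions). -/
structure LTS where
  State : Type
  Tr : State → ℕ → State → Prop

namespace LTS

/-- `R` is a simulation between the states of `T₁` and those of `T₂`. -/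
def IsSimulation (T₁ T₂ : LTS) (R : T₁.State → T₂.State → Prop) : Prop :=
  ∀ s t, R s t → ∀ a s', T₁.Tr s a s' → ∃ t', T₂.Tr t a t' ∧ R s' t'

/-- The simulation preorder: `s` is simulated by `t`. -/
def Simulated (T₁ T₂ : LTS) (s : T₁.State) (t : T₂.State) : Prop :=
  ∃ R, IsSimulation T₁ T₂ R ∧ R s t

/-- `t` is reachable from `s`. -/
def Reachable (T : LTS) (s t : T.State) : Prop :=
  Relation.ReflTransGen (fun x y => ∃ a, T.Tr x a y) s t

/-- A process is deterministic if every process reachable from it has, for each action,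
at most one successor. -/
def DeterministicFrom (T : LTS) (s : T.State) : Prop :=
  ∀ t, T.Reachable s t → ∀ a u v, T.Tr t a u → T.Tr t a v → u = v

end LTS

/-! ### Proc expressions -/

/-- Proc expressions; the set of constants is `ℕ`. -/
inductive Expr : Type
  | eps : Expr
  | const (X : ℕ) : Expr
  | seq (E F : Expr) : Expr
  | par (E F : Expr) : Expr

namespace Expr

/-- The constants that occur in an expression. -/
def consts : Expr → Set ℕ
  | eps => ∅
  | const X => {X}
  | seq E F => consts E ∪ consts F
  | par E F => consts E ∪ consts F

/-- Structural congruence. -/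
inductive Cong : Expr → Expr → Prop
  | refl (E) : Cong E E
  | symm {E F} : Cong E F → Cong F E
  | trans {E F G} : Cong E F → Cong F G → Cong E G
  | seq {E E' F F'} : Cong E E' → Cong F F' → Cong (Expr.seq E F) (Expr.seq E' F')
  | par {E E' F F'} : Cong E E' → Cong F F' → Cong (Expr.par E F) (Expr.par E' F')
  | seq_assoc (E F G) : Cong (Expr.seq (Expr.seq E F) G) (Expr.seq E (Expr.seq F G))
  | par_assoc (E F G) : Cong (Expr.par (Expr.par E F) G) (Expr.par E (Expr.par F G))
  | eps_seq (E) : Cong (Expr.seq eps E) E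
  | seq_eps (E) : Cong (Expr.seq E eps) E
  | eps_par (E) : Cong (Expr.par eps E) E
  | par_comm (E F) : Cong (Expr.par E F) (Expr.par F E)

instance setoid : Setoid Expr where
  r := Cong
  iseqv := ⟨Cong.refl, Cong.symm, Cong.trans⟩

theorem Cong.consts_eq {E F : Expr} (h : Cong E F) : consts E = consts F := by
  induction h with
  | refl => rfl
  | symm _ ih => exact ih.symm
  | trans _ _ ih₁ ih₂ => exact ih₁.trans ih₂
  | seq _ _ ih₁ ih₂ => simp only [consts, ih₁, ih₂]
  | par _ _ ih₁ ih₂ => simp only [consts, ih₁, ih₂]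
  | seq_assoc => simp only [consts, Set.union_assoc]
  | par_assoc => simp only [consts, Set.union_assoc]
  | eps_seq => simp only [consts, Set.empty_union]
  | seq_eps => simp only [consts, Set.union_empty]
  | eps_par => simp only [consts, Set.empty_union]
  | par_comm => simp only [consts, Set.union_comm]

/-- Goedel numbering of expressions. -/
def toNat : Expr → ℕ
  | eps => 0
  | const X => 3 * X + 1
  | seq E F => 3 * Nat.pair (toNat E) (toNat F) + 2
  | par E F => 3 * Nat.pair (toNat E) (toNat F) + 3

/-- The expression with a given Goedel number. -/
def ofNat : ℕ → Expr
  | 0 => eps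
  | n + 1 =>
    have h₁ : (Nat.unpair (n / 3)).1 < n + 1 :=
      Nat.lt_succ_of_le ((Nat.unpair_left_le _).trans (Nat.div_le_self _ _))
    have h₂ : (Nat.unpair (n / 3)).2 < n + 1 :=
      Nat.lt_succ_of_le ((Nat.unpair_right_le _).trans (Nat.div_le_self _ _))
    if n % 3 = 0 then const (n / 3)
    else if n % 3 = 1 then
      seq (ofNat (Nat.unpair (n / 3)).1) (ofNat (Nat.unpair (n / 3)).2)
    else par (ofNat (Nat.unpair (n / 3)).1) (ofNat (Nat.unpair (n / 3)).2)

theorem ofNat_toNat (E : Expr) : ofNat (toNat E) = E := by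
  induction E with
  | eps => rw [toNat, ofNat]
  | const X =>
    have h : 3 * X / 3 = X := by omega
    rw [toNat, ofNat, if_pos (by omega), h]
  | seq E F ihE ihF =>
    have h (q : ℕ) : (3 * q + 1) / 3 = q := by omega
    rw [toNat, ofNat, if_neg (by omega), if_pos (by omega), h, Nat.unpair_pair]
    simp only [ihE, ihF]
  | par E F ihE ihF =>
    have h (q : ℕ) : (3 * q + 2) / 3 = q := by omega
    rw [toNat, ofNat, if_neg (by omega), if_neg (by omega), h, Nat.unpair_pair]
    simp only [ihE, ihF]

theorem toNat_ofNat (n : ℕ) : toNat (ofNat n) = n := by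
  induction n using Nat.strong_induction_on with
  | _ n ih =>
    cases n with
    | zero => rw [ofNat, toNat]
    | succ n =>
      have h₁ := ih (Nat.unpair (n / 3)).1
        (Nat.lt_succ_of_le ((Nat.unpair_left_le _).trans (Nat.div_le_self _ _)))
      have h₂ := ih (Nat.unpair (n / 3)).2
        (Nat.lt_succ_of_le ((Nat.unpair_right_le _).trans (Nat.div_le_self _ _)))
      rw [ofNat]
      split_ifs
      · rw [toNat]; omega
      · rw [toNat, h₁, h₂, Nat.pair_unpair]; omega
      · rw [toNat, h₁, h₂, Nat.pair_unpair]; omega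

instance : Denumerable Expr :=
  Denumerable.mk' ⟨toNat, ofNat, ofNat_toNat, toNat_ofNat⟩

end Expr

/-- Proc expressions modulo structural congruence. -/
abbrev Proc : Type := Quotient Expr.setoid

namespace Proc

/-- The class of the expression `E`. -/
def mk (E : Expr) : Proc := Quotient.mk Expr.setoid E

/-- Sequential composition. -/
def seq : Proc → Proc → Proc :=
  Quotient.map₂ Expr.seq fun _ _ h _ _ h' => Expr.Cong.seq h h'

/-- Parallel composition. -/
def par : Proc → Proc → Proc :=
  Quotient.map₂ Expr.par fun _ _ h _ _ h' => Expr.Cong.par h h'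

/-- The constants that occur in a process. -/
def consts : Proc → Set ℕ :=
  Quotient.lift Expr.consts fun _ _ h => Expr.Cong.consts_eq h

end Proc

/-! ### Proc rewrite systems -/

/-- A process rewrite system: a finite list of rules `(E, a, F)`, read `E -a-> F`. -/
abbrev PRS : Type := List (Expr × ℕ × Expr)

namespace PRS

/-- The constants that occur in the rules. -/
def consts (Δ : PRS) : Set ℕ :=
  {X | ∃ r ∈ Δ, X ∈ r.1.consts ∨ X ∈ r.2.2.consts}

/-- The transition relation generated by the rules, modulo structural congruence. -/
inductive Step (Δ : PRS) : Proc → ℕ → Proc → Prop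
  | rule {E : Expr} {a : ℕ} {F : Expr} :
      (E, a, F) ∈ Δ → Step Δ (Proc.mk E) a (Proc.mk F)
  | seq {E : Proc} {a : ℕ} {F : Proc} (G : Proc) :
      Step Δ E a F → Step Δ (E.seq G) a (F.seq G)
  | par {E : Proc} {a : ℕ} {F : Proc} (G : Proc) :
      Step Δ E a F → Step Δ (E.par G) a (F.par G)

/-- The rules have left-hand sides in `A` and right-hand sides in `B`. -/
def Restricted (Δ : PRS) (A B : Set Proc) : Prop :=
  ∀ r ∈ Δ, Proc.mk r.1 ∈ A ∧ Proc.mk r.2.2 ∈ B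

/-- The states of the transition system of an `(A, B)`-restricted system `Δ`: the processes
in `B` all of whose constants occur in `Δ`. -/
def states (Δ : PRS) (B : Set Proc) : Set Proc :=
  {E | E ∈ B ∧ E.consts ⊆ Δ.consts}

/-- The transition system of an `(A, B)`-restricted system `Δ`. -/
def lts (Δ : PRS) (B : Set Proc) : LTS where
  State := Δ.states B
  Tr s a t := Step Δ s.1 a t.1

/-- The processes that consist of a single constant. -/
def constants : Set Proc := Set.range fun X => Proc.mk (Expr.const X)

/-- Finite-state systems. -/
def IsFS (Δ : PRS) : Prop := Δ.Restricted constants constants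

/-- PA systems. -/
def IsPA (Δ : PRS) : Prop := Δ.Restricted constants Set.univ

/-- The transition system of a finite-state system. -/
abbrev fsLTS (Δ : PRS) : LTS := Δ.lts constants

/-- The transition system of a PA system. -/
abbrev paLTS (Δ : PRS) : LTS := Δ.lts Set.univ

end PRS

/-! ### Counter machines -/

/-- Instructions of a counter machine with `m` counters (labels start at `1`). -/
inductive Instr (m : ℕ) : Type
  /-- `c_j := c_j + 1; goto k` -/
  | inc (j : Fin m) (k : ℕ) : Instr m
  /-- `if c_j = 0 then goto k else (c_j := c_j - 1; goto l)` -/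
  | test (j : Fin m) (k l : ℕ) : Instr m

namespace Instr

/-- Instructions as tuples, used to encode them. -/
def equivSum (m : ℕ) : Instr m ≃ (Fin m × ℕ) ⊕ (Fin m × ℕ × ℕ) where
  toFun
    | inc j k => Sum.inl (j, k)
    | test j k l => Sum.inr (j, k, l)
  invFun
    | Sum.inl (j, k) => inc j k
    | Sum.inr (j, k, l) => test j k l
  left_inv x := by cases x <;> rfl
  right_inv x := by rcases x with ⟨_, _⟩ | ⟨_, _, _⟩ <;> rfl

instance (m : ℕ) : Primcodable (Instr m) := Primcodable.ofEquiv _ (equivSum m)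

/-- All jump targets lie in `{1, …, n}`. -/
def TargetsIn (n : ℕ) {m : ℕ} : Instr m → Prop
  | inc _ k => 1 ≤ k ∧ k ≤ n
  | test _ k l => (1 ≤ k ∧ k ≤ n) ∧ (1 ≤ l ∧ l ≤ n)

end Instr

/-- A counter machine, given by the list of its instructions number `1, …, n - 1`;
instruction number `n` is `halt`. -/
abbrev CounterMachine (m : ℕ) : Type := List (Instr m)

namespace CounterMachine

variable {m : ℕ}

/-- The number `n` of instructions, including the final `halt`. -/
def size (M : CounterMachine m) : ℕ := M.length + 1

/-- All jumps go to existing instructions. -/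
def WellFormed (M : CounterMachine m) : Prop := ∀ I ∈ M, I.TargetsIn M.size

/-- `I` is the instruction number `i` (for `1 ≤ i < n`). -/
def InstrAt (M : CounterMachine m) (i : ℕ) (I : Instr m) : Prop :=
  ∃ p, i = p + 1 ∧ M[p]? = some I

/-- One step; a configuration is the current instruction number with the counter values. -/
inductive Step (M : CounterMachine m) : ℕ × (Fin m → ℕ) → ℕ × (Fin m → ℕ) → Prop
  | inc {i j k c} : M.InstrAt i (Instr.inc j k) →
      Step M (i, c) (k, Function.update c j (c j + 1))
  | zero {i j k l c} : M.InstrAt i (Instr.test j k l) → c j = 0 →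
      Step M (i, c) (k, c)
  | dec {i j k l c} : M.InstrAt i (Instr.test j k l) → c j ≠ 0 →
      Step M (i, c) (l, Function.update c j (c j - 1))

/-- Started at instruction `1` with all counters zero, the machine reaches `halt`. -/
def Halts (M : CounterMachine m) : Prop :=
  ∃ c, Relation.ReflTransGen M.Step (1, fun _ => 0) (M.size, c)

end CounterMachine

/-! ### The processes associated with a two-counter machine -/

/-- The action `i_j` (increment). -/
def actI (j : Fin 2) : ℕ := j
/-- The action `d_j` (decrement). -/
def actD (j : Fin 2) : ℕ := 2 + j
/-- The action `z_j` (zero test). -/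
def actZ (j : Fin 2) : ℕ := 4 + j
/-- All six actions. -/
def actions : List ℕ := [actI 0, actI 1, actD 0, actD 1, actZ 0, actZ 1]

/-- The constant `Z_j`. -/
def constZ (j : Fin 2) : Expr := Expr.const j
/-- The constant `C_j`. -/
def constC (j : Fin 2) : Expr := Expr.const (2 + j)

/-- The rules of the counter number `j`. -/
def counterRules (j : Fin 2) : PRS :=
  [(constZ j, actZ j, constZ j),
   (constZ j, actI j, (constC j).seq (constZ j)),
   (constC j, actI j, (constC j).seq (constC j)),
   (constC j, actD j, Expr.eps)]

/-- The PA system of two counters. -/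
def counterPA : PRS := counterRules 0 ++ counterRules 1

/-- The process `Z_1 ‖ Z_2`: two counters with value zero. -/
def zeroCounters : Expr := (constZ 0).par (constZ 1)

/-- The constant `u`, which enables all actions forever. -/
def constU : Expr := Expr.const 0
/-- The constant `f_i`, for an instruction number `i ≥ 1`. -/
def constF (i : ℕ) : Expr := Expr.const i

/-- The actions, with the numbers of the instructions they lead to, that
an instruction of the machine prescribes. -/
def Instr.moves : Instr 2 → List (ℕ × ℕ)
  | .inc j k => [(actI j, k)]
  | .test j k l => [(actZ j, k), (actD j, l)]

/-- The rules for the instruction `I` with number `i`: those prescribed by `I`, and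
a rule `f_i -a-> u` for every other action `a`, which enforces the former. -/
def instrRules (i : ℕ) (I : Instr 2) : PRS :=
  I.moves.map (fun x => (constF i, x.1, constF x.2)) ++
  (actions.filter fun a => a ∉ I.moves.map Prod.fst).map fun a => (constF i, a, constU)

/-- The finite-state system of a two-counter machine. -/
def controlFS (M : CounterMachine 2) : PRS :=
  actions.map (fun a => (constU, a, constU)) ++
  M.zipIdx.flatMap fun x => instrRules (x.2 + 1) x.1

end ProcRewrite

namespace ProcRewrite

/-! ### Transitions of PA systems, by the structure of expressions -/

namespace Proc

/-! The process `Z_1 ‖ Z_2` is a pair of counters: up to congruence, its reachable states are two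
stacks of heights `c`. It always offers `i_j`, it offers `z_j` only if `c_j = 0`, and `d_j` only if
`c_j ≠ 0` (`step_counterProc_iff`). This rests on `IsPA.step_mk_iff`: as left-hand sides are single
constants, transitions can be read off any representative.

The control is deterministic. At `f_i` the actions prescribed by instruction `i` lead to the next
instruction, and all others lead to `u`, which matches the counters forever (`step_controlFS_iff`).
The joint moves of the counters and the prescribed part of the control are the steps of the machine.
If the machine halts, determinism puts every configuration of its run into any simulation, and the
last one fails: `f_n` is stuck while a counter can be incremented (`not_halts_of_simulated`). If it
does not halt, the visited configurations together with all pairs containing `u` form a simulation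
(`simulated_of_not_halts`).

Since the control is computable from the machine, undecidability follows from that of halting for
two counters (`not_exists_partrec_not_halts`). Partial recursive functions are translated into while
programs on registers (`computes_of_partrec'`), and these into two-counter code: one counter holds
the registers as prime exponents, the other is work space (`Exec.runs_compile`). The resulting
machine halts on a terminating computation exactly when the result is zero
(`exists_machine_halts_iff`). Thus only terminating computations have to be followed, nothing is
claimed where the function is undefined, and a diagonal argument finishes the proof. -/

theorem mk_eq_iff {E F : Expr} : mk E = mk F ↔ Expr.Cong E F :=
  ⟨fun h => Quotient.exact h, fun h => Quotient.sound h⟩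

theorem seq_mk (E F : Expr) : (mk E).seq (mk F) = mk (E.seq F) := rfl

theorem par_mk (E F : Expr) : (mk E).par (mk F) = mk (E.par F) := rfl

theorem exists_mk (P : Proc) : ∃ E, mk E = P := Quotient.exists_rep P

theorem seq_assoc (P Q R : Proc) : (P.seq Q).seq R = P.seq (Q.seq R) := by
  obtain ⟨E, rfl⟩ := exists_mk P
  obtain ⟨F, rfl⟩ := exists_mk Q
  obtain ⟨G, rfl⟩ := exists_mk R
  exact mk_eq_iff.2 (.seq_assoc E F G)

theorem par_assoc (P Q R : Proc) : (P.par Q).par R = P.par (Q.par R) := by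
  obtain ⟨E, rfl⟩ := exists_mk P
  obtain ⟨F, rfl⟩ := exists_mk Q
  obtain ⟨G, rfl⟩ := exists_mk R
  exact mk_eq_iff.2 (.par_assoc E F G)

theorem par_comm (P Q : Proc) : P.par Q = Q.par P := by
  obtain ⟨E, rfl⟩ := exists_mk P
  obtain ⟨F, rfl⟩ := exists_mk Q
  exact mk_eq_iff.2 (.par_comm E F)

theorem eps_seq (P : Proc) : (mk .eps).seq P = P := by
  obtain ⟨E, rfl⟩ := exists_mk P
  exact mk_eq_iff.2 (.eps_seq E)

theorem seq_eps (P : Proc) : P.seq (mk .eps) = P := by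
  obtain ⟨E, rfl⟩ := exists_mk P
  exact mk_eq_iff.2 (.seq_eps E)

theorem eps_par (P : Proc) : (mk .eps).par P = P := by
  obtain ⟨E, rfl⟩ := exists_mk P
  exact mk_eq_iff.2 (.eps_par E)

theorem mk_const_inj {X Y : ℕ} : mk (.const X) = mk (.const Y) ↔ X = Y := by
  refine ⟨fun h => ?_, fun h => h ▸ rfl⟩
  simpa [Expr.consts] using (mk_eq_iff.1 h).consts_eq

end Proc

namespace Expr

/-- The unit laws collapse such an expression. Having no constants is therefore a
congruence-invariant test for `ε`, which decides whether the second factor of a sequential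
composition may move. -/
theorem cong_eps_of_consts_eq_empty {E : Expr} (h : E.consts = ∅) : Cong E eps := by
  induction E with
  | eps => exact .refl _
  | const X => simp [consts] at h
  | seq E F ihE ihF =>
    rw [consts, Set.union_empty_iff] at h
    exact (Cong.seq (ihE h.1) (ihF h.2)).trans (.eps_seq _)
  | par E F ihE ihF =>
    rw [consts, Set.union_empty_iff] at h
    exact (Cong.par (ihE h.1) (ihF h.2)).trans (.eps_par _)

/-- The `a`-successors of an expression in a PA system, computed along its structure. -/
def Succ (Δ : PRS) : Expr → ℕ → Proc → Prop
  | eps, _, _ => False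
  | const X, a, Q => ∃ E F, (E, a, F) ∈ Δ ∧ Proc.mk E = Proc.mk (const X) ∧ Q = Proc.mk F
  | seq E F, a, Q => (∃ P, Succ Δ E a P ∧ Q = P.seq (Proc.mk F)) ∨ (E.consts = ∅ ∧ Succ Δ F a Q)
  | par E F, a, Q => (∃ P, Succ Δ E a P ∧ Q = P.par (Proc.mk F)) ∨
      (∃ P, Succ Δ F a P ∧ Q = P.par (Proc.mk E))

/-- The generated transitions act on congruence classes, where the shape of an expression is
invisible. This invariance is what gives the structural computation a meaning on classes. -/
theorem Cong.succ_iff {Δ : PRS} {E F : Expr} (h : Cong E F) (a : ℕ) (Q : Proc) :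
    Succ Δ E a Q ↔ Succ Δ F a Q := by
  induction h generalizing Q with
  | refl => rfl
  | symm _ ih => exact (ih Q).symm
  | trans _ _ ih₁ ih₂ => exact (ih₁ Q).trans (ih₂ Q)
  | seq h₁ h₂ ih₁ ih₂ => simp only [Succ, ih₁, ih₂, h₁.consts_eq, Proc.mk_eq_iff.2 h₂]
  | par h₁ h₂ ih₁ ih₂ =>
    simp only [Succ, ih₁, ih₂, Proc.mk_eq_iff.2 h₁, Proc.mk_eq_iff.2 h₂]
  | seq_assoc E F G =>
    simp only [Succ, consts, Set.union_empty_iff, ← Proc.seq_mk]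
    constructor
    · rintro (⟨P, ⟨P, hP, rfl⟩ | ⟨hE, hP⟩, rfl⟩ | ⟨⟨hE, hF⟩, hG⟩)
      · exact .inl ⟨P, hP, Proc.seq_assoc _ _ _⟩
      · exact .inr ⟨hE, .inl ⟨P, hP, rfl⟩⟩
      · exact .inr ⟨hE, .inr ⟨hF, hG⟩⟩
    · rintro (⟨P, hP, rfl⟩ | ⟨hE, ⟨P, hP, rfl⟩ | ⟨hF, hG⟩⟩)
      · exact .inl ⟨_, .inl ⟨P, hP, rfl⟩, (Proc.seq_assoc _ _ _).symm⟩
      · exact .inl ⟨P, .inr ⟨hE, hP⟩, rfl⟩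
      · exact .inr ⟨⟨hE, hF⟩, hG⟩
  | par_assoc E F G =>
    simp only [Succ, ← Proc.par_mk]
    constructor
    · rintro (⟨P, ⟨P, hP, rfl⟩ | ⟨P, hP, rfl⟩, rfl⟩ | ⟨P, hP, rfl⟩)
      · exact .inl ⟨P, hP, Proc.par_assoc _ _ _⟩
      · refine .inr ⟨_, .inl ⟨P, hP, rfl⟩, ?_⟩
        rw [Proc.par_assoc, Proc.par_assoc, Proc.par_comm (Proc.mk E)]
      · refine .inr ⟨_, .inr ⟨P, hP, rfl⟩, ?_⟩
        rw [Proc.par_assoc, Proc.par_comm (Proc.mk E)]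
    · rintro (⟨P, hP, rfl⟩ | ⟨P, ⟨P, hP, rfl⟩ | ⟨P, hP, rfl⟩, rfl⟩)
      · exact .inl ⟨_, .inl ⟨P, hP, rfl⟩, (Proc.par_assoc _ _ _).symm⟩
      · refine .inl ⟨_, .inr ⟨P, hP, rfl⟩, ?_⟩
        rw [Proc.par_assoc, Proc.par_assoc, Proc.par_comm (Proc.mk E)]
      · refine .inr ⟨P, hP, ?_⟩
        rw [Proc.par_assoc, Proc.par_comm (Proc.mk E)]
  | eps_seq E => simp [Succ, consts]
  | seq_eps E => simp [Succ, Proc.seq_eps]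
  | eps_par E =>
    have (P : Proc) : P.par (Proc.mk eps) = P := by rw [Proc.par_comm, Proc.eps_par]
    simp [Succ, this]
  | par_comm E F => simp only [Succ, or_comm]

end Expr

namespace PRS

theorem IsFS.isPA {Δ : PRS} (h : Δ.IsFS) : Δ.IsPA := fun r hr => ⟨(h r hr).1, trivial⟩

theorem IsPA.step_mk_iff {Δ : PRS} (hΔ : Δ.IsPA) (E : Expr) (a : ℕ) (Q : Proc) :
    Step Δ (Proc.mk E) a Q ↔ E.Succ Δ a Q := by
  constructor
  · intro h
    generalize hP : Proc.mk E = P at h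
    induction h generalizing E with
    | @rule L a R hr =>
      obtain ⟨X, hX⟩ := (hΔ _ hr).1
      rw [(Proc.mk_eq_iff.1 (hP.trans hX.symm)).succ_iff]
      exact ⟨L, R, hr, hX.symm, rfl⟩
    | @seq P a Q G _ ih =>
      obtain ⟨P, rfl⟩ := P.exists_mk
      obtain ⟨G, rfl⟩ := G.exists_mk
      rw [(Proc.mk_eq_iff.1 hP).succ_iff]
      exact .inl ⟨Q, ih P rfl, rfl⟩
    | @par P a Q G _ ih =>
      obtain ⟨P, rfl⟩ := P.exists_mk
      obtain ⟨G, rfl⟩ := G.exists_mk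
      rw [(Proc.mk_eq_iff.1 hP).succ_iff]
      exact .inl ⟨Q, ih P rfl, rfl⟩
  · intro h
    induction E generalizing Q with
    | eps => exact h.elim
    | const X =>
      obtain ⟨L, R, hr, hL, rfl⟩ := h
      exact hL ▸ .rule hr
    | seq E F ihE ihF =>
      rcases h with ⟨P, hP, rfl⟩ | ⟨hE, hF⟩
      · exact .seq (Proc.mk F) (ihE _ hP)
      · rw [← Proc.seq_mk, Proc.mk_eq_iff.2 (Expr.cong_eps_of_consts_eq_empty hE), Proc.eps_seq]
        exact ihF _ hF
    | par E F ihE ihF =>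
      rcases h with ⟨P, hP, rfl⟩ | ⟨P, hP, rfl⟩
      · exact .par (Proc.mk F) (ihE _ hP)
      · rw [← Proc.par_mk, Proc.par_comm]
        exact .par _ (ihF _ hP)

end PRS

/-! ### The counters -/

theorem counterPA_isPA : counterPA.IsPA := by
  intro r hr
  refine ⟨?_, trivial⟩
  simp only [counterPA, counterRules, List.cons_append, List.nil_append, List.mem_cons,
    List.not_mem_nil, or_false] at hr
  rcases hr with rfl | rfl | rfl | rfl | rfl | rfl | rfl | rfl <;> exact ⟨_, rfl⟩

/-- The expression `C_j. … .C_j.Z_j` with `n` occurrences of `C_j`. -/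
def counterExpr (j : Fin 2) : ℕ → Expr
  | 0 => constZ j
  | n + 1 => (constC j).seq (counterExpr j n)

/-- The process of two counters with values `c`. -/
def counterProc (c : Fin 2 → ℕ) : Proc :=
  Proc.mk ((counterExpr 0 (c 0)).par (counterExpr 1 (c 1)))

theorem mem_counterPA_iff {E F : Expr} {a : ℕ} : (E, a, F) ∈ counterPA ↔
    ∃ j, (E = constZ j ∧ a = actZ j ∧ F = constZ j) ∨
      (E = constZ j ∧ a = actI j ∧ F = (constC j).seq (constZ j)) ∨
      (E = constC j ∧ a = actI j ∧ F = (constC j).seq (constC j)) ∨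
      (E = constC j ∧ a = actD j ∧ F = .eps) := by
  simp only [counterPA, counterRules, List.cons_append, List.nil_append, List.mem_cons,
    List.not_mem_nil, or_false, Prod.mk.injEq, Fin.exists_fin_two, or_assoc]

theorem mk_constZ_inj {j k : Fin 2} : Proc.mk (constZ j) = Proc.mk (constZ k) ↔ j = k := by
  rw [constZ, constZ, Proc.mk_const_inj, Fin.ext_iff]

theorem mk_constC_inj {j k : Fin 2} : Proc.mk (constC j) = Proc.mk (constC k) ↔ j = k := by
  rw [constC, constC, Proc.mk_const_inj, Fin.ext_iff, add_right_inj]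

theorem mk_constZ_ne_mk_constC (j k : Fin 2) : Proc.mk (constZ j) ≠ Proc.mk (constC k) := by
  rw [constZ, constC, Ne, Proc.mk_const_inj]
  omega

theorem succ_constZ_iff (j : Fin 2) (a : ℕ) (Q : Proc) :
    (constZ j).Succ counterPA a Q ↔
      (a = actZ j ∧ Q = Proc.mk (constZ j)) ∨
        (a = actI j ∧ Q = Proc.mk ((constC j).seq (constZ j))) := by
  change (∃ E F, (E, a, F) ∈ counterPA ∧ Proc.mk E = Proc.mk (constZ j) ∧ Q = Proc.mk F) ↔ _
  simp only [mem_counterPA_iff]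
  constructor
  · rintro ⟨E, F, ⟨k, ⟨rfl, rfl, rfl⟩ | ⟨rfl, rfl, rfl⟩ | ⟨rfl, rfl, rfl⟩ | ⟨rfl, rfl, rfl⟩⟩, hE, rfl⟩
    · exact .inl (mk_constZ_inj.1 hE ▸ ⟨rfl, rfl⟩)
    · exact .inr (mk_constZ_inj.1 hE ▸ ⟨rfl, rfl⟩)
    all_goals exact absurd hE.symm (mk_constZ_ne_mk_constC _ _)
  · rintro (⟨rfl, rfl⟩ | ⟨rfl, rfl⟩)
    · exact ⟨constZ j, constZ j, ⟨j, .inl ⟨rfl, rfl, rfl⟩⟩, rfl, rfl⟩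
    · exact ⟨constZ j, _, ⟨j, .inr (.inl ⟨rfl, rfl, rfl⟩)⟩, rfl, rfl⟩

theorem succ_constC_iff (j : Fin 2) (a : ℕ) (Q : Proc) :
    (constC j).Succ counterPA a Q ↔
      (a = actI j ∧ Q = Proc.mk ((constC j).seq (constC j))) ∨
        (a = actD j ∧ Q = Proc.mk .eps) := by
  change (∃ E F, (E, a, F) ∈ counterPA ∧ Proc.mk E = Proc.mk (constC j) ∧ Q = Proc.mk F) ↔ _
  simp only [mem_counterPA_iff]
  constructor
  · rintro ⟨E, F, ⟨k, ⟨rfl, rfl, rfl⟩ | ⟨rfl, rfl, rfl⟩ | ⟨rfl, rfl, rfl⟩ | ⟨rfl, rfl, rfl⟩⟩, hE, rfl⟩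
    · exact absurd hE (mk_constZ_ne_mk_constC _ _)
    · exact absurd hE (mk_constZ_ne_mk_constC _ _)
    · exact .inl (mk_constC_inj.1 hE ▸ ⟨rfl, rfl⟩)
    · exact .inr (mk_constC_inj.1 hE ▸ ⟨rfl, rfl⟩)
  · rintro (⟨rfl, rfl⟩ | ⟨rfl, rfl⟩)
    · exact ⟨constC j, _, ⟨j, .inr (.inr (.inl ⟨rfl, rfl, rfl⟩))⟩, rfl, rfl⟩
    · exact ⟨constC j, _, ⟨j, .inr (.inr (.inr ⟨rfl, rfl, rfl⟩))⟩, rfl, rfl⟩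

/-- Only the top of the stack moves. Pushing yields `(C.C).E`, which reassociates to `C.(C.E)`;
popping yields `ε.E`; the bottom `Z` is exposed only at height zero. -/
theorem succ_counterExpr_iff (j : Fin 2) (n a : ℕ) (Q : Proc) :
    (counterExpr j n).Succ counterPA a Q ↔
      (a = actI j ∧ Q = Proc.mk (counterExpr j (n + 1))) ∨
      (n = 0 ∧ a = actZ j ∧ Q = Proc.mk (counterExpr j n)) ∨
      (n ≠ 0 ∧ a = actD j ∧ Q = Proc.mk (counterExpr j (n - 1))) := by
  cases n with
  | zero =>
    rw [counterExpr, succ_constZ_iff, or_comm]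
    simp [counterExpr]
  | succ n =>
    have h : ¬ (constC j).consts = ∅ := by simp [constC, Expr.consts]
    simp only [counterExpr, Expr.Succ, h, false_and, or_false, succ_constC_iff, ne_eq,
      Nat.add_eq_zero_iff, one_ne_zero, and_false, not_false_eq_true, true_and, false_or,
      Nat.add_sub_cancel]
    constructor
    · rintro ⟨P, ⟨rfl, rfl⟩ | ⟨rfl, rfl⟩, rfl⟩
      · exact .inl ⟨rfl, Proc.seq_assoc (Proc.mk (constC j)) (Proc.mk (constC j)) _⟩
      · exact .inr ⟨rfl, Proc.eps_seq _⟩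
    · rintro (⟨rfl, rfl⟩ | ⟨rfl, rfl⟩)
      · exact ⟨_, .inl ⟨rfl, rfl⟩,
        (Proc.seq_assoc (Proc.mk (constC j)) (Proc.mk (constC j)) (Proc.mk (counterExpr j n))).symm⟩
      · exact ⟨_, .inr ⟨rfl, rfl⟩, (Proc.eps_seq _).symm⟩

theorem step_counterProc_iff (c : Fin 2 → ℕ) (a : ℕ) (Q : Proc) :
    PRS.Step counterPA (counterProc c) a Q ↔ ∃ j,
      (a = actI j ∧ Q = counterProc (Function.update c j (c j + 1))) ∨
      (c j = 0 ∧ a = actZ j ∧ Q = counterProc c) ∨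
      (c j ≠ 0 ∧ a = actD j ∧ Q = counterProc (Function.update c j (c j - 1))) := by
  -- In `Expr.Succ` the component that moves is written first, so a move of counter `1` swaps the
  -- two; commutativity restores the order.
  have key (x y : ℕ) : (Proc.mk (counterExpr 1 y)).par (Proc.mk (counterExpr 0 x)) =
      (Proc.mk (counterExpr 0 x)).par (Proc.mk (counterExpr 1 y)) := Proc.par_comm _ _
  rw [counterProc, counterPA_isPA.step_mk_iff, Expr.Succ, Fin.exists_fin_two]
  simp only [succ_counterExpr_iff, counterProc, ← Proc.par_mk, Function.update_self, ne_eq,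
    Fin.reduceEq, not_false_eq_true, Function.update_of_ne]
  refine or_congr ?_ ?_
  · constructor
    · rintro ⟨P, ⟨h, rfl⟩ | ⟨h, h', rfl⟩ | ⟨h, h', rfl⟩, rfl⟩ <;> simp [*]
    · rintro (⟨h, rfl⟩ | ⟨h, h', rfl⟩ | ⟨h, h', rfl⟩)
      · exact ⟨_, .inl ⟨h, rfl⟩, rfl⟩
      · exact ⟨_, .inr (.inl ⟨h, h', rfl⟩), rfl⟩
      · exact ⟨_, .inr (.inr ⟨h, h', rfl⟩), rfl⟩
  · constructor
    · rintro ⟨P, ⟨h, rfl⟩ | ⟨h, h', rfl⟩ | ⟨h, h', rfl⟩, rfl⟩ <;> simp [*]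
    · rintro (⟨h, rfl⟩ | ⟨h, h', rfl⟩ | ⟨h, h', rfl⟩)
      · exact ⟨_, .inl ⟨h, rfl⟩, (key _ _).symm⟩
      · exact ⟨_, .inr (.inl ⟨h, h', rfl⟩), (key _ _).symm⟩
      · exact ⟨_, .inr (.inr ⟨h, h', rfl⟩), (key _ _).symm⟩

theorem actI_inj {j k : Fin 2} : actI j = actI k ↔ j = k := by simp only [actI]; omega

theorem actD_inj {j k : Fin 2} : actD j = actD k ↔ j = k := by simp only [actD]; omega

theorem actZ_inj {j k : Fin 2} : actZ j = actZ k ↔ j = k := by simp only [actZ]; omega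

theorem actI_ne_actD (j k : Fin 2) : actI j ≠ actD k := by simp only [actI, actD]; omega

theorem actI_ne_actZ (j k : Fin 2) : actI j ≠ actZ k := by simp only [actI, actZ]; omega

theorem actD_ne_actZ (j k : Fin 2) : actD j ≠ actZ k := by simp only [actD, actZ]; omega

theorem actI_mem_actions (j : Fin 2) : actI j ∈ actions := by fin_cases j <;> simp [actions]

theorem actD_mem_actions (j : Fin 2) : actD j ∈ actions := by fin_cases j <;> simp [actions]

theorem actZ_mem_actions (j : Fin 2) : actZ j ∈ actions := by fin_cases j <;> simp [actions]

theorem step_counterProc_unique {c : Fin 2 → ℕ} {a : ℕ} {P Q : Proc}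
    (hP : PRS.Step counterPA (counterProc c) a P) (hQ : PRS.Step counterPA (counterProc c) a Q) :
    P = Q := by
  rw [step_counterProc_iff] at hP hQ
  obtain ⟨j, ⟨ha, rfl⟩ | ⟨hc, ha, rfl⟩ | ⟨hc, ha, rfl⟩⟩ := hP <;>
    obtain ⟨k, ⟨hb, rfl⟩ | ⟨hd, hb, rfl⟩ | ⟨hd, hb, rfl⟩⟩ := hQ <;> rw [ha] at hb
  -- The pair of two zero tests is already closed, since both leave the counters unchanged.
  · rw [actI_inj.1 hb]
  · exact absurd hb (actI_ne_actZ _ _)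
  · exact absurd hb (actI_ne_actD _ _)
  · exact absurd hb.symm (actI_ne_actZ _ _)
  · exact absurd hb.symm (actD_ne_actZ _ _)
  · exact absurd hb.symm (actI_ne_actD _ _)
  · exact absurd hb (actD_ne_actZ _ _)
  · rw [actD_inj.1 hb]

theorem step_counterProc_cases {c : Fin 2 → ℕ} {a : ℕ} {Q : Proc}
    (h : PRS.Step counterPA (counterProc c) a Q) :
    a ∈ actions ∧ ∃ c', Q = counterProc c' := by
  obtain ⟨j, ⟨rfl, rfl⟩ | ⟨-, rfl, rfl⟩ | ⟨-, rfl, rfl⟩⟩ := (step_counterProc_iff _ _ _).1 h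
  · exact ⟨actI_mem_actions j, _, rfl⟩
  · exact ⟨actZ_mem_actions j, _, rfl⟩
  · exact ⟨actD_mem_actions j, _, rfl⟩

theorem consts_counterExpr_subset (j : Fin 2) (n : ℕ) :
    (counterExpr j n).consts ⊆ counterPA.consts := by
  induction n with
  | zero =>
    intro X hX
    exact ⟨_, mem_counterPA_iff.2 ⟨j, .inl ⟨rfl, rfl, rfl⟩⟩, .inl hX⟩
  | succ n ih =>
    refine Set.union_subset (fun X hX => ?_) ih
    exact ⟨_, mem_counterPA_iff.2 ⟨j, .inr (.inr (.inr ⟨rfl, rfl, rfl⟩))⟩, .inl hX⟩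

theorem counterProc_mem_states (c : Fin 2 → ℕ) : counterProc c ∈ counterPA.states Set.univ :=
  ⟨trivial, Set.union_subset (consts_counterExpr_subset _ _) (consts_counterExpr_subset _ _)⟩

/-- Two counters with values `c`, as a state of the transition system of `counterPA`. -/
def counterState (c : Fin 2 → ℕ) : counterPA.paLTS.State :=
  ⟨counterProc c, counterProc_mem_states c⟩

theorem counterPA_deterministicFrom (c : Fin 2 → ℕ) :
    counterPA.paLTS.DeterministicFrom (counterState c) := by
  intro t ht
  obtain ⟨c', rfl⟩ : ∃ c', t = counterState c' := by
    induction ht with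
    | refl => exact ⟨c, rfl⟩
    | tail _ h ih =>
      obtain ⟨c', rfl⟩ := ih
      obtain ⟨a, h⟩ := h
      obtain ⟨-, c'', h⟩ := step_counterProc_cases h
      exact ⟨c'', Subtype.ext h⟩
  intro a u v hu hv
  exact Subtype.ext (step_counterProc_unique hu hv)

/-! ### The control -/

theorem Instr.moves_unique {I : Instr 2} {a k l : ℕ} (hk : (a, k) ∈ I.moves)
    (hl : (a, l) ∈ I.moves) : k = l := by
  cases I with
  | inc j k => simp_all [moves]
  | test j k l =>
    simp only [moves, List.mem_cons, List.not_mem_nil, or_false, Prod.mk.injEq] at hk hl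
    have := actD_ne_actZ j j
    grind

theorem mem_instrRules_iff {i : ℕ} {I : Instr 2} {E F : Expr} {a : ℕ} :
    (E, a, F) ∈ instrRules i I ↔ E = constF i ∧ ((∃ k, (a, k) ∈ I.moves ∧ F = constF k) ∨
      (a ∈ actions ∧ (∀ k, (a, k) ∉ I.moves) ∧ F = constU)) := by
  simp only [instrRules, List.mem_append, List.mem_map, List.mem_filter, decide_eq_true_eq,
    Prod.mk.injEq, Prod.exists, exists_and_right, exists_eq_right]
  constructor
  · rintro (⟨b, k, h, rfl, rfl, rfl⟩ | ⟨b, ⟨hb, h⟩, rfl, rfl, rfl⟩)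
    · exact ⟨rfl, .inl ⟨k, h, rfl⟩⟩
    · exact ⟨rfl, .inr ⟨hb, fun k hk => h ⟨k, hk⟩, rfl⟩⟩
  · rintro ⟨rfl, ⟨k, h, rfl⟩ | ⟨ha, h, rfl⟩⟩
    · exact .inl ⟨a, k, h, rfl, rfl, rfl⟩
    · exact .inr ⟨a, ⟨ha, fun ⟨k, hk⟩ => h k hk⟩, rfl, rfl, rfl⟩

theorem mem_controlFS_iff {M : CounterMachine 2} {E F : Expr} {a : ℕ} :
    (E, a, F) ∈ controlFS M ↔ (a ∈ actions ∧ E = constU ∧ F = constU) ∨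
      ∃ i I, M.InstrAt i I ∧ (E, a, F) ∈ instrRules i I := by
  simp only [controlFS, List.mem_append, List.mem_map, List.mem_flatMap, Prod.exists,
    List.mem_zipIdx_iff_getElem?, Prod.mk.injEq, CounterMachine.InstrAt]
  refine or_congr ?_ ?_
  · constructor
    · rintro ⟨b, hb, rfl, rfl, rfl⟩
      exact ⟨hb, rfl, rfl⟩
    · rintro ⟨hb, rfl, rfl⟩
      exact ⟨a, hb, rfl, rfl, rfl⟩
  · constructor
    · rintro ⟨I, p, hp, h⟩
      exact ⟨p + 1, I, ⟨p, rfl, hp⟩, h⟩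
    · rintro ⟨i, I, ⟨p, rfl, hp⟩, h⟩
      exact ⟨I, p, hp, h⟩

/-- Labels start at `1`, so the constant `0`, which is `u`, never clashes with an `f_i`. -/
theorem CounterMachine.InstrAt.pos {m : ℕ} {M : CounterMachine m} {i : ℕ} {I : Instr m}
    (h : M.InstrAt i I) : i ≠ 0 := by
  obtain ⟨p, rfl, -⟩ := h
  exact p.succ_ne_zero

theorem CounterMachine.InstrAt.unique {m : ℕ} {M : CounterMachine m} {i : ℕ} {I J : Instr m}
    (hI : M.InstrAt i I) (hJ : M.InstrAt i J) : I = J := by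
  obtain ⟨p, rfl, hp⟩ := hI
  obtain ⟨q, hq, hq'⟩ := hJ
  obtain rfl : p = q := by omega
  exact Option.some.inj (hp.symm.trans hq')

theorem controlFS_isFS (M : CounterMachine 2) : (controlFS M).IsFS := by
  rintro ⟨E, a, F⟩ h
  rcases mem_controlFS_iff.1 h with ⟨-, rfl, rfl⟩ | ⟨i, I, -, h⟩
  · exact ⟨⟨_, rfl⟩, _, rfl⟩
  · obtain ⟨rfl, ⟨k, -, rfl⟩ | ⟨-, -, rfl⟩⟩ := mem_instrRules_iff.1 h <;>
      exact ⟨⟨_, rfl⟩, _, rfl⟩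

/-- With `X = 0` this also covers `u`, since `constF 0` and `constU` are the same constant. -/
theorem step_controlFS_iff (M : CounterMachine 2) (X a : ℕ) (Q : Proc) :
    PRS.Step (controlFS M) (Proc.mk (constF X)) a Q ↔
      (X = 0 ∧ a ∈ actions ∧ Q = Proc.mk constU) ∨
      ∃ I, M.InstrAt X I ∧ ((∃ k, (a, k) ∈ I.moves ∧ Q = Proc.mk (constF k)) ∨
        (a ∈ actions ∧ (∀ k, (a, k) ∉ I.moves) ∧ Q = Proc.mk constU)) := by
  rw [(controlFS_isFS M).isPA.step_mk_iff]
  change (∃ E F, (E, a, F) ∈ controlFS M ∧ Proc.mk E = Proc.mk (constF X) ∧ Q = Proc.mk F) ↔ _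
  simp only [mem_controlFS_iff, mem_instrRules_iff]
  constructor
  · rintro ⟨E, F, ⟨ha, rfl, rfl⟩ | ⟨i, I, hI, rfl, h⟩, hE, rfl⟩
    · exact .inl ⟨(Proc.mk_const_inj.1 hE).symm, ha, rfl⟩
    · obtain rfl := Proc.mk_const_inj.1 hE
      refine .inr ⟨I, hI, ?_⟩
      obtain ⟨k, hk, rfl⟩ | ⟨ha, hk, rfl⟩ := h
      · exact .inl ⟨k, hk, rfl⟩
      · exact .inr ⟨ha, hk, rfl⟩
  · rintro (⟨rfl, ha, rfl⟩ | ⟨I, hI, ⟨k, hk, rfl⟩ | ⟨ha, hk, rfl⟩⟩)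
    · exact ⟨constU, constU, .inl ⟨ha, rfl, rfl⟩, rfl, rfl⟩
    · exact ⟨constF X, constF k, .inr ⟨X, I, hI, rfl, .inl ⟨k, hk, rfl⟩⟩, rfl, rfl⟩
    · exact ⟨constF X, constU, .inr ⟨X, I, hI, rfl, .inr ⟨ha, hk, rfl⟩⟩, rfl, rfl⟩

theorem step_controlFS_unique {M : CounterMachine 2} {X a : ℕ} {P Q : Proc}
    (hP : PRS.Step (controlFS M) (Proc.mk (constF X)) a P)
    (hQ : PRS.Step (controlFS M) (Proc.mk (constF X)) a Q) : P = Q := by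
  rw [step_controlFS_iff] at hP hQ
  rcases hP with ⟨hX, -, rfl⟩ | ⟨I, hI, hP⟩
  · rcases hQ with ⟨-, -, rfl⟩ | ⟨I, hI, -⟩
    · rfl
    · exact absurd hX hI.pos
  · rcases hQ with ⟨hX, -, -⟩ | ⟨J, hJ, hQ⟩
    · exact absurd hX hI.pos
    · obtain rfl := hI.unique hJ
      rcases hP with ⟨k, hk, rfl⟩ | ⟨-, hk, rfl⟩ <;> rcases hQ with ⟨l, hl, rfl⟩ | ⟨-, hl, rfl⟩
      · rw [Instr.moves_unique hk hl]
      · exact absurd hk (hl _)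
      · exact absurd hl (hk _)
      · rfl

theorem controlFS_deterministicFrom (M : CounterMachine 2) (s : (controlFS M).fsLTS.State) :
    (controlFS M).fsLTS.DeterministicFrom s := by
  rintro ⟨_, ⟨X, rfl⟩, hX⟩ - a u v hu hv
  exact Subtype.ext (step_controlFS_unique hu hv)

theorem step_controlFS_mem_states {M : CounterMachine 2} {X a : ℕ} {Q : Proc}
    (h : PRS.Step (controlFS M) (Proc.mk (constF X)) a Q) :
    Q ∈ (controlFS M).states PRS.constants := by
  rw [(controlFS_isFS M).isPA.step_mk_iff] at h
  obtain ⟨E, F, hr, -, rfl⟩ := h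
  exact ⟨(controlFS_isFS M _ hr).2, fun X hX => ⟨_, hr, .inr hX⟩⟩

theorem constF_mem_states {M : CounterMachine 2} {i : ℕ} {I : Instr 2} (h : M.InstrAt i I) :
    Proc.mk (constF i) ∈ (controlFS M).states PRS.constants := by
  -- Any of the six actions would do: `f_i` has a rule for each of them.
  obtain ⟨F, hF⟩ : ∃ F, (constF i, actI 0, F) ∈ instrRules i I := by
    by_cases hk : ∃ k, (actI 0, k) ∈ I.moves
    · obtain ⟨k, hk⟩ := hk
      exact ⟨constF k, mem_instrRules_iff.2 ⟨rfl, .inl ⟨k, hk, rfl⟩⟩⟩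
    · exact ⟨constU, mem_instrRules_iff.2 ⟨rfl, .inr ⟨actI_mem_actions 0, not_exists.1 hk, rfl⟩⟩⟩
  exact ⟨⟨i, rfl⟩, fun X hX => ⟨_, mem_controlFS_iff.2 (.inr ⟨i, I, h, hF⟩), .inl hX⟩⟩

/-! ### Correctness of the construction -/

/-- A step of the machine, seen as a transition of the counters and one of the control. -/
theorem CounterMachine.Step.exists_action {M : CounterMachine 2} {i i' : ℕ} {c c' : Fin 2 → ℕ}
    (h : M.Step (i, c) (i', c')) :
    ∃ a, PRS.Step counterPA (counterProc c) a (counterProc c') ∧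
      ∃ I, M.InstrAt i I ∧ (a, i') ∈ I.moves := by
  simp only [step_counterProc_iff]
  cases h with
  | @inc _ j _ _ hI => exact ⟨_, ⟨j, .inl ⟨rfl, rfl⟩⟩, _, hI, by simp [Instr.moves]⟩
  | @zero _ j _ _ _ hI h0 =>
    exact ⟨_, ⟨j, .inr (.inl ⟨h0, rfl, rfl⟩)⟩, _, hI, by simp [Instr.moves]⟩
  | @dec _ j _ _ _ hI h0 =>
    exact ⟨_, ⟨j, .inr (.inr ⟨h0, rfl, rfl⟩)⟩, _, hI, by simp [Instr.moves]⟩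

/-- Joint transitions of the counters and the control are steps of the machine. -/
theorem CounterMachine.exists_step {M : CounterMachine 2} {i k a : ℕ} {c : Fin 2 → ℕ}
    {I : Instr 2} {Q : Proc} (hI : M.InstrAt i I) (hk : (a, k) ∈ I.moves)
    (h : PRS.Step counterPA (counterProc c) a Q) :
    ∃ c', Q = counterProc c' ∧ M.Step (i, c) (k, c') := by
  rw [step_counterProc_iff] at h
  cases I with
  | inc j k' =>
    simp only [Instr.moves, List.mem_singleton, Prod.mk.injEq] at hk
    obtain ⟨rfl, rfl⟩ := hk
    obtain ⟨l, ⟨hb, rfl⟩ | ⟨-, hb, -⟩ | ⟨-, hb, -⟩⟩ := h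
    · obtain rfl := actI_inj.1 hb
      exact ⟨_, rfl, .inc hI⟩
    · exact absurd hb (actI_ne_actZ _ _)
    · exact absurd hb (actI_ne_actD _ _)
  | test j k' l' =>
    simp only [Instr.moves, List.mem_cons, List.not_mem_nil, or_false, Prod.mk.injEq] at hk
    obtain ⟨rfl, rfl⟩ | ⟨rfl, rfl⟩ := hk <;>
      obtain ⟨l, ⟨hb, rfl⟩ | ⟨hc, hb, rfl⟩ | ⟨hc, hb, rfl⟩⟩ := h
    · exact absurd hb.symm (actI_ne_actZ _ _)
    · obtain rfl := actZ_inj.1 hb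
      exact ⟨_, rfl, .zero hI hc⟩
    · exact absurd hb.symm (actD_ne_actZ _ _)
    · exact absurd hb.symm (actI_ne_actD _ _)
    · exact absurd hb (actD_ne_actZ _ _)
    · obtain rfl := actD_inj.1 hb
      exact ⟨_, rfl, .dec hI hc⟩

/-- This makes `f_n` a deadlock of the control. -/
theorem CounterMachine.not_instrAt_size {m : ℕ} (M : CounterMachine m) (I : Instr m) :
    ¬ M.InstrAt M.size I := by
  rintro ⟨p, hp, h⟩
  obtain rfl : M.length = p := by simpa [size] using hp
  simp at h

theorem CounterMachine.exists_instrAt {m : ℕ} (M : CounterMachine m) {i : ℕ} (h₀ : 1 ≤ i)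
    (h₁ : i ≤ M.size) (h₂ : i ≠ M.size) : ∃ I, M.InstrAt i I := by
  obtain ⟨p, rfl⟩ := Nat.exists_eq_add_of_le' h₀
  have hp : p < M.length := by unfold size at h₁ h₂; omega
  exact ⟨M[p], p, rfl, List.getElem?_eq_getElem hp⟩

/-- The configurations reachable from the initial one. -/
def CounterMachine.Visits {m : ℕ} (M : CounterMachine m) (i : ℕ) (c : Fin m → ℕ) : Prop :=
  Relation.ReflTransGen M.Step (1, fun _ => 0) (i, c)

theorem CounterMachine.WellFormed.visits_range {m : ℕ} {M : CounterMachine m} (hM : M.WellFormed)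
    {i : ℕ} {c : Fin m → ℕ} (h : M.Visits i c) : 1 ≤ i ∧ i ≤ M.size := by
  unfold Visits at h
  generalize hy : (i, c) = y at h
  cases h with
  | refl =>
    obtain ⟨rfl, -⟩ := Prod.mk.inj hy
    exact ⟨le_rfl, Nat.le_add_left _ _⟩
  | tail _ h =>
    subst hy
    cases h with
    | inc hI =>
      obtain ⟨p, -, hp⟩ := hI
      exact hM _ (List.mem_of_getElem? hp)
    | zero hI =>
      obtain ⟨p, -, hp⟩ := hI
      exact (hM _ (List.mem_of_getElem? hp)).1
    | dec hI =>
      obtain ⟨p, -, hp⟩ := hI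
      exact (hM _ (List.mem_of_getElem? hp)).2

/-- The control has no choice of answer, so following the run of the machine keeps every visited
configuration inside the given simulation. -/
theorem not_halts_of_simulated {M : CounterMachine 2}
    (hf : Proc.mk (constF 1) ∈ (controlFS M).states PRS.constants)
    (h : LTS.Simulated counterPA.paLTS (controlFS M).fsLTS (counterState fun _ => 0)
      ⟨Proc.mk (constF 1), hf⟩) : ¬ M.Halts := by
  obtain ⟨R, hR, h₁⟩ := h
  have key {y} (hy : Relation.ReflTransGen M.Step (1, fun _ => 0) y) :
      ∃ t, t.1 = Proc.mk (constF y.1) ∧ R (counterState y.2) t := by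
    induction hy with
    | refl => exact ⟨_, rfl, h₁⟩
    | @tail y z _ hyz ih =>
      obtain ⟨t, ht, hyt⟩ := ih
      obtain ⟨a, ha, I, hI, hk⟩ := hyz.exists_action
      obtain ⟨t', ht', hzt⟩ := hR _ _ hyt a (counterState z.2) ha
      refine ⟨t', ?_, hzt⟩
      replace ht' : PRS.Step (controlFS M) t.1 a t'.1 := ht'
      rw [ht] at ht'
      exact step_controlFS_unique ht' ((step_controlFS_iff _ _ _ _).2 (.inr ⟨I, hI, .inl ⟨_, hk, rfl⟩⟩))
  rintro ⟨c, hc⟩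
  obtain ⟨t, ht, hct⟩ := key hc
  -- At `halt` the counters still offer an increment, which the control cannot answer.
  obtain ⟨t', ht', -⟩ := hR _ _ hct (actI 0) (counterState (Function.update c 0 (c 0 + 1)))
    ((step_counterProc_iff _ _ _).2 ⟨0, .inl ⟨rfl, rfl⟩⟩)
  replace ht' : PRS.Step (controlFS M) t.1 (actI 0) t'.1 := ht'
  rw [ht, step_controlFS_iff] at ht'
  rcases ht' with ⟨h, -⟩ | ⟨I, hI, -⟩
  · exact absurd h (Nat.succ_ne_zero _)
  · exact M.not_instrAt_size I hI

theorem simulated_of_not_halts {M : CounterMachine 2} (hM : M.WellFormed)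
    (hf : Proc.mk (constF 1) ∈ (controlFS M).states PRS.constants) (h : ¬ M.Halts) :
    LTS.Simulated counterPA.paLTS (controlFS M).fsLTS (counterState fun _ => 0)
      ⟨Proc.mk (constF 1), hf⟩ := by
  refine ⟨fun s t => ∃ c, s = counterState c ∧
    (t.1 = Proc.mk constU ∨ ∃ i, t.1 = Proc.mk (constF i) ∧ M.Visits i c), ?_,
    _, rfl, .inr ⟨1, rfl, .refl⟩⟩
  rintro _ t ⟨c, rfl, ht⟩ a s' hs
  obtain ⟨ha, c', hc'⟩ := step_counterProc_cases hs
  -- Targets of transitions are automatically states, so it suffices to answer with a bare process.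
  suffices H : ∃ Q, PRS.Step (controlFS M) t.1 a Q ∧ ∃ c, s' = counterState c ∧
      (Q = Proc.mk constU ∨ ∃ i, Q = Proc.mk (constF i) ∧ M.Visits i c) by
    obtain ⟨Q, hQ, h⟩ := H
    obtain ⟨X, hX⟩ := t.2.1
    refine ⟨⟨Q, step_controlFS_mem_states (M := M) (X := X) (a := a) ?_⟩, hQ, h⟩
    exact (congrArg (fun P => PRS.Step (controlFS M) P a Q) hX).mpr hQ
  rcases ht with ht | ⟨i, ht, hi⟩ <;> rw [ht]
  · exact ⟨_, (step_controlFS_iff M 0 _ _).2 (.inl ⟨rfl, ha, rfl⟩), c', Subtype.ext hc', .inl rfl⟩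
  · obtain ⟨I, hI⟩ := M.exists_instrAt (hM.visits_range hi).1 (hM.visits_range hi).2
      fun h' => h ⟨c, h' ▸ hi⟩
    by_cases hk : ∃ k, (a, k) ∈ I.moves
    · obtain ⟨k, hk⟩ := hk
      obtain ⟨c'', hc'', hstep⟩ := CounterMachine.exists_step hI hk hs
      exact ⟨_, (step_controlFS_iff _ _ _ _).2 (.inr ⟨I, hI, .inl ⟨k, hk, rfl⟩⟩),
        c'', Subtype.ext hc'', .inr ⟨k, rfl, hi.tail hstep⟩⟩
    · exact ⟨_, (step_controlFS_iff _ _ _ _).2 (.inr ⟨I, hI, .inr ⟨ha, not_exists.1 hk, rfl⟩⟩),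
        c', Subtype.ext hc', .inl rfl⟩

theorem constF_one_mem_states {M : CounterMachine 2} (hM : M ≠ []) :
    Proc.mk (constF 1) ∈ (controlFS M).states PRS.constants := by
  obtain ⟨I, L, rfl⟩ := List.exists_cons_of_ne_nil hM
  exact constF_mem_states ⟨0, rfl, rfl⟩

theorem simulated_iff_not_halts {M : CounterMachine 2} (hM : M.WellFormed)
    (hf : Proc.mk (constF 1) ∈ (controlFS M).states PRS.constants) :
    LTS.Simulated counterPA.paLTS (controlFS M).fsLTS (counterState fun _ => 0)
      ⟨Proc.mk (constF 1), hf⟩ ↔ ¬ M.Halts :=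
  ⟨not_halts_of_simulated hf, simulated_of_not_halts hM hf⟩

/-! ### Computability of the construction -/

theorem primrec_const : Primrec Expr.const :=
  Primrec.encode_iff.1 <| (Primrec.nat_add.comp
    (Primrec.nat_mul.comp (Primrec.const 3) .id) (Primrec.const 1)).of_eq fun _ => rfl

theorem primrec_moves : Primrec Instr.moves := by
  have hI : Primrec actI := .dom_finite _
  have hD : Primrec actD := .dom_finite _
  have hZ : Primrec actZ := .dom_finite _
  have h₁ : Primrec fun x : Fin 2 × ℕ => [(actI x.1, x.2)] :=
    Primrec.list_cons.comp (.pair (hI.comp .fst) .snd) (.const [])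
  have h₂ : Primrec fun x : Fin 2 × ℕ × ℕ => [(actZ x.1, x.2.1), (actD x.1, x.2.2)] :=
    Primrec.list_cons.comp (.pair (hZ.comp .fst) (Primrec.fst.comp .snd)) <|
      Primrec.list_cons.comp (.pair (hD.comp .fst) (Primrec.snd.comp .snd)) (.const [])
  refine (Primrec.sumCasesOn (.of_equiv (e := Instr.equivSum 2)) (h₁.comp₂ .right)
    (h₂.comp₂ .right)).of_eq fun I => ?_
  cases I <;> rfl

/-- The filtered list depends on the kind of instruction and on its counter, but not on the jump
targets; for each kind this is a function on a finite type. -/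
theorem primrec_inert : Primrec fun I : Instr 2 =>
    actions.filter fun a => a ∉ I.moves.map Prod.fst := by
  have h₁ : Primrec fun x : Fin 2 × ℕ => actions.filter fun a => a ∉ [actI x.1] :=
    (Primrec.dom_finite fun j : Fin 2 => actions.filter fun a => a ∉ [actI j]).comp .fst
  have h₂ : Primrec fun x : Fin 2 × ℕ × ℕ => actions.filter fun a => a ∉ [actZ x.1, actD x.1] :=
    (Primrec.dom_finite fun j : Fin 2 => actions.filter fun a => a ∉ [actZ j, actD j]).comp .fst
  refine (Primrec.sumCasesOn (.of_equiv (e := Instr.equivSum 2)) (h₁.comp₂ .right)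
    (h₂.comp₂ .right)).of_eq fun I => ?_
  cases I <;> rfl

theorem primrec_instrRules : Primrec₂ instrRules := by
  have hF : Primrec constF := primrec_const
  refine Primrec.list_append.comp₂ ?_ ?_
  · refine Primrec.list_map (primrec_moves.comp .snd) ?_
    exact Primrec.pair (hF.comp (Primrec.fst.comp .fst))
      (Primrec.pair (Primrec.fst.comp .snd) (hF.comp (Primrec.snd.comp .snd)))
  · refine Primrec.list_map (primrec_inert.comp .snd) ?_
    exact Primrec.pair (hF.comp (Primrec.fst.comp .fst)) (Primrec.pair .snd (.const constU))

/-- Rewrites the enumeration by operations whose primitive recursiveness is used in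
`primrec_controlFS`. -/
theorem zipIdx_eq_flatMap_range {α : Type*} (l : List α) :
    l.zipIdx = (List.range l.length).flatMap fun n => l[n]?.toList.map fun x => (x, n) := by
  induction l using List.reverseRecOn with
  | nil => rfl
  | append_singleton l a ih =>
    rw [List.zipIdx_append, ih, List.length_append, List.length_singleton, List.range_succ,
      List.flatMap_append]
    congr 1
    · refine List.flatMap_congr fun n hn => ?_
      rw [List.getElem?_append_left (List.mem_range.1 hn)]
    · simp

theorem primrec_controlFS : Primrec controlFS := by
  have hz : Primrec fun M : CounterMachine 2 => M.zipIdx := by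
    refine (Primrec.list_flatMap (Primrec.list_range.comp .list_length) ?_).of_eq
      fun M => (zipIdx_eq_flatMap_range M).symm
    refine Primrec.list_map (Primrec.optionToList.comp (Primrec.list_getElem?.comp .fst .snd)) ?_
    exact Primrec.pair .snd (Primrec.snd.comp .fst)
  refine Primrec.list_append.comp (.const _) (Primrec.list_flatMap hz ?_)
  exact primrec_instrRules.comp (Primrec.succ.comp (Primrec.snd.comp .snd))
    (Primrec.fst.comp .snd)

/-! ### A while language for partial recursive functions -/

/-- Programs on registers with natural number contents. -/
inductive Prog : Type
  | skip : Prog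
  /-- increment a register -/
  | inc (r : ℕ) : Prog
  | seq (p q : Prog) : Prog
  /-- while `r ≠ 0` do decrement `r` and then run `p` -/
  | loop (r : ℕ) (p : Prog) : Prog

namespace Prog

open Function (update update_self update_of_ne)

/-- `p` started with register contents `σ` terminates with contents `τ`. -/
inductive Exec : Prog → (ℕ → ℕ) → (ℕ → ℕ) → Prop
  | skip (σ) : Exec skip σ σ
  | inc (r σ) : Exec (inc r) σ (update σ r (σ r + 1))
  | seq {p q σ τ υ} : Exec p σ τ → Exec q τ υ → Exec (seq p q) σ υ
  | loop_zero {r p σ} : σ r = 0 → Exec (loop r p) σ σ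
  | loop_succ {r p σ τ υ k} : σ r = k + 1 → Exec p (update σ r k) τ → Exec (loop r p) τ υ →
      Exec (loop r p) σ υ

/-- A total-correctness rule: `k` counts the remaining rounds, and the body must leave the loop
register as it found it after the decrement. -/
theorem Exec.loop_invariant {r : ℕ} {p : Prog} (P : ℕ → (ℕ → ℕ) → Prop)
    (h : ∀ k σ, σ r = k + 1 → P (k + 1) σ → ∃ τ, Exec p (update σ r k) τ ∧ τ r = k ∧ P k τ)
    (k : ℕ) : ∀ σ, σ r = k → P k σ → ∃ τ, Exec (loop r p) σ τ ∧ τ r = 0 ∧ P 0 τ := by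
  induction k with
  | zero => exact fun σ hr hP => ⟨σ, .loop_zero hr, hr, hP⟩
  | succ k ih =>
    intro σ hr hP
    obtain ⟨τ, hτ, hr', hP'⟩ := h k σ hr hP
    obtain ⟨υ, hυ, hr'', hP''⟩ := ih τ hr' hP'
    exact ⟨υ, .loop_succ hr hτ hυ, hr'', hP''⟩

/-- Set a register to zero. -/
def clear (r : ℕ) : Prog := loop r skip

theorem exec_clear (r : ℕ) (σ : ℕ → ℕ) :
    ∃ τ, Exec (clear r) σ τ ∧ τ r = 0 ∧ ∀ x ≠ r, τ x = σ x := by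
  refine Exec.loop_invariant (fun _ τ => ∀ x ≠ r, τ x = σ x) ?_ (σ r) σ rfl fun _ _ => rfl
  exact fun k τ _ h => ⟨_, .skip _, update_self .., fun x hx => (update_of_ne hx ..).trans (h x hx)⟩

theorem exec_loop_inc {r s : ℕ} (hrs : r ≠ s) (σ : ℕ → ℕ) :
    ∃ τ, Exec (loop r (inc s)) σ τ ∧ τ r = 0 ∧ τ s = σ s + σ r ∧
      ∀ x, x ≠ r → x ≠ s → τ x = σ x := by
  obtain ⟨τ, hτ, h₀, h₁, h₂⟩ := Exec.loop_invariant (r := r) (p := inc s)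
    (fun k τ => τ s + k = σ s + σ r ∧ ∀ x, x ≠ r → x ≠ s → τ x = σ x)
    (by
      rintro k τ hk ⟨h₁, h₂⟩
      refine ⟨_, .inc _ _, ?_, ?_, fun x hx hx' => ?_⟩
      · rw [update_of_ne hrs, update_self]
      · rw [update_self, update_of_ne hrs.symm]; omega
      · rw [update_of_ne hx', update_of_ne hx, h₂ x hx hx'])
    (σ r) σ rfl ⟨rfl, fun _ _ _ => rfl⟩
  exact ⟨τ, hτ, h₀, h₁, h₂⟩

theorem exec_loop_inc_inc {r s t : ℕ} (hrs : r ≠ s) (hrt : r ≠ t) (hst : s ≠ t) (σ : ℕ → ℕ) :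
    ∃ τ, Exec (loop r ((inc s).seq (inc t))) σ τ ∧ τ r = 0 ∧ τ s = σ s + σ r ∧ τ t = σ t + σ r ∧
      ∀ x, x ≠ r → x ≠ s → x ≠ t → τ x = σ x := by
  obtain ⟨τ, hτ, h₀, h₁, h₂, h₃⟩ := Exec.loop_invariant (r := r) (p := (inc s).seq (inc t))
    (fun k τ => τ s + k = σ s + σ r ∧ τ t + k = σ t + σ r ∧
      ∀ x, x ≠ r → x ≠ s → x ≠ t → τ x = σ x)
    (by
      rintro k τ hk ⟨h₁, h₂, h₃⟩
      refine ⟨_, .seq (.inc _ _) (.inc _ _), ?_, ?_, ?_, fun x hx hx' hx'' => ?_⟩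
      · rw [update_of_ne hrt, update_of_ne hrs, update_self]
      · rw [update_of_ne hst, update_self, update_of_ne hrs.symm]; omega
      · rw [update_self, update_of_ne hst.symm, update_of_ne hrt.symm]; omega
      · rw [update_of_ne hx'', update_of_ne hx', update_of_ne hx, h₃ x hx hx' hx''])
    (σ r) σ rfl ⟨rfl, rfl, fun _ _ _ _ => rfl⟩
  exact ⟨τ, hτ, h₀, h₁, h₂, h₃⟩

/-- Copy register `r` to `s`, with `t` as auxiliary register. -/
def copy (r s t : ℕ) : Prog :=
  ((clear s).seq (clear t)).seq ((loop r ((inc s).seq (inc t))).seq (loop t (inc r)))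

/-- A loop destroys its register, so `r` is poured into `s` and `t` simultaneously and then refilled
from `t`. -/
theorem exec_copy {r s t : ℕ} (hrs : r ≠ s) (hrt : r ≠ t) (hst : s ≠ t) (σ : ℕ → ℕ) :
    ∃ τ, Exec (copy r s t) σ τ ∧ τ s = σ r ∧ ∀ x, x ≠ s → x ≠ t → τ x = σ x := by
  obtain ⟨σ₁, e₁, h₁, h₁'⟩ := exec_clear s σ
  obtain ⟨σ₂, e₂, h₂, h₂'⟩ := exec_clear t σ₁
  obtain ⟨σ₃, e₃, h₃, h₃s, h₃t, h₃'⟩ := exec_loop_inc_inc hrs hrt hst σ₂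
  obtain ⟨σ₄, e₄, h₄, h₄r, h₄'⟩ := exec_loop_inc hrt.symm σ₃
  have hr : σ₂ r = σ r := by rw [h₂' r hrt, h₁' r hrs]
  refine ⟨σ₄, .seq (.seq e₁ e₂) (.seq e₃ e₄), ?_, fun x hs ht => ?_⟩
  · rw [h₄' s hst hrs.symm, h₃s, h₂' s hst, h₁, hr, zero_add]
  · by_cases hx : x = r
    · rw [hx, h₄r, h₃, h₃t, h₂, hr, zero_add, zero_add]
    · rw [h₄' x ht hx, h₃' x hx hs ht, h₂' x ht, h₁' x hs]

/-- `R` is computed by a program that reads its arguments in given registers below `b`,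
leaves its result in register `b`, and does not change the registers below `b`. -/
def Computes {n : ℕ} (R : List.Vector ℕ n → ℕ → Prop) : Prop :=
  ∀ (b : ℕ) (a : Fin n → ℕ), (∀ i, a i < b) → ∃ p : Prog, ∀ (σ : ℕ → ℕ) (v : List.Vector ℕ n),
    (∀ i, v.get i = σ (a i)) → ∀ y, R v y →
      ∃ τ, Exec p σ τ ∧ τ b = y ∧ ∀ x < b, τ x = σ x

/-- Nothing is required of the program when `R v y` fails for all `y`, so shrinking the relation is
free. -/
theorem Computes.mono {n : ℕ} {R S : List.Vector ℕ n → ℕ → Prop} (hS : Computes S)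
    (h : ∀ v y, R v y → S v y) : Computes R := fun b a ha =>
  let ⟨p, hp⟩ := hS b a ha
  ⟨p, fun σ v hv y hy => hp σ v hv y (h v y hy)⟩

theorem computes_zero : Computes (n := 0) fun _ y => y = 0 := by
  intro b _ _
  refine ⟨clear b, fun σ _ _ y hy => ?_⟩
  obtain ⟨τ, hτ, h, h'⟩ := exec_clear b σ
  exact ⟨τ, hτ, h.trans hy.symm, fun x hx => h' x hx.ne⟩

theorem computes_get {n : ℕ} (i : Fin n) : Computes fun v y => y = v.get i := by
  intro b a ha
  have hi := ha i
  refine ⟨copy (a i) b (b + 1), fun σ v hv y hy => ?_⟩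
  obtain ⟨τ, hτ, h, h'⟩ := exec_copy (r := a i) (s := b) (t := b + 1)
    (by omega) (by omega) (by omega) σ
  exact ⟨τ, hτ, by rw [h, hy, hv], fun x hx => h' x (by omega) (by omega)⟩

theorem computes_succ : Computes (n := 1) fun v y => y = v.head + 1 := by
  intro b a ha
  obtain ⟨p, hp⟩ := computes_get (0 : Fin 1) b a ha
  refine ⟨p.seq (inc b), fun σ v hv y hy => ?_⟩
  obtain ⟨τ, hτ, h, h'⟩ := hp σ v hv _ rfl
  refine ⟨_, hτ.seq (.inc _ _), ?_, fun x hx => ?_⟩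
  · rw [update_self, h, hy, List.Vector.get_zero]
  · rw [update_of_ne hx.ne, h' x hx]

/-- The `i`-th program works from register `b + i` on, and hence preserves both the arguments and
the earlier results. -/
theorem exists_exec_all {m n : ℕ} {R : Fin n → List.Vector ℕ m → ℕ → Prop}
    (hR : ∀ i, Computes (R i)) (b : ℕ) (a : Fin m → ℕ) (ha : ∀ i, a i < b) :
    ∃ p : Prog, ∀ (σ : ℕ → ℕ) (v : List.Vector ℕ m), (∀ i, v.get i = σ (a i)) →
      ∀ w : Fin n → ℕ, (∀ i, R i v (w i)) →
        ∃ τ, Exec p σ τ ∧ (∀ i : Fin n, τ (b + i) = w i) ∧ ∀ x < b, τ x = σ x := by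
  induction n with
  | zero => exact ⟨skip, fun σ _ _ _ _ => ⟨σ, .skip σ, fun i => i.elim0, fun _ _ => rfl⟩⟩
  | succ n ih =>
    obtain ⟨p, hp⟩ := ih fun i => hR i.castSucc
    obtain ⟨q, hq⟩ := hR (Fin.last n) (b + n) a fun i => (ha i).trans_le (Nat.le_add_right _ _)
    refine ⟨p.seq q, fun σ v hv w hw => ?_⟩
    obtain ⟨τ, hτ, h, h'⟩ := hp σ v hv (fun i => w i.castSucc) fun i => hw _
    obtain ⟨υ, hυ, g, g'⟩ := hq τ v (fun i => (hv i).trans (h' _ (ha i)).symm) _ (hw (Fin.last n))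
    refine ⟨υ, hτ.seq hυ, fun i => ?_, fun x hx => ?_⟩
    · cases i using Fin.lastCases with
      | last => exact g
      | cast i => rw [Fin.val_castSucc, g' _ (Nat.add_lt_add_left i.2 b)]; exact h i
    · rw [g' x (hx.trans_le (Nat.le_add_right _ _)), h' x hx]

theorem Computes.comp {m n : ℕ} {S : List.Vector ℕ n → ℕ → Prop}
    {R : Fin n → List.Vector ℕ m → ℕ → Prop} (hS : Computes S) (hR : ∀ i, Computes (R i)) :
    Computes fun v y => ∃ w : List.Vector ℕ n, (∀ i, R i v (w.get i)) ∧ S w y := by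
  intro b a ha
  obtain ⟨p, hp⟩ := exists_exec_all hR b a ha
  -- The inner results occupy `b, …, b + n - 1`, so the outer program works above them; its result
  -- is finally copied down to `b`.
  obtain ⟨q, hq⟩ := hS (b + n + 1) (fun i => b + i) fun i => by omega
  refine ⟨p.seq (q.seq (copy (b + n + 1) b (b + n + 2))), ?_⟩
  rintro σ v hv y ⟨w, hw, hy⟩
  obtain ⟨σ₁, e₁, h₁, h₁'⟩ := hp σ v hv w.get hw
  obtain ⟨σ₂, e₂, h₂, h₂'⟩ := hq σ₁ w (fun i => (h₁ i).symm) y hy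
  obtain ⟨σ₃, e₃, h₃, h₃'⟩ := exec_copy (r := b + n + 1) (s := b) (t := b + n + 2)
    (by omega) (by omega) (by omega) σ₂
  refine ⟨σ₃, e₁.seq (e₂.seq e₃), h₃.trans h₂, fun x hx => ?_⟩
  rw [h₃' x (by omega) (by omega), h₂' x (by omega), h₁' x hx]

theorem Computes.prec {n : ℕ} {f : List.Vector ℕ n → ℕ} {g : List.Vector ℕ (n + 2) → ℕ}
    (hf : Computes fun v y => y = f v) (hg : Computes fun v y => y = g v) :
    Computes fun (v : List.Vector ℕ (n + 1)) y =>
      y = v.head.rec (f v.tail) fun y IH => g (y ::ᵥ IH ::ᵥ v.tail) := by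
  intro b a ha
  have ha₀ := ha 0
  -- Register layout: `b` counts the remaining rounds, `b + 1` holds the recursion index, `b + 2`
  -- the value at that index, `b + 3` the next value; `b + 4` is scratch.
  obtain ⟨p, hp⟩ := hf (b + 2) (fun i => a i.succ) fun i => by have := ha i.succ; omega
  obtain ⟨q, hq⟩ := hg (b + 3) (Fin.cons (b + 1) (Fin.cons (b + 2) fun i => a i.succ)) fun i => by
    refine Fin.cases ?_ (fun i => Fin.cases ?_ (fun i => ?_) i) i
    · simp
    · simp
    · have := ha i.succ
      simp only [Fin.cons_succ]
      omega
  refine ⟨((copy (a 0) b (b + 1)).seq ((clear (b + 1)).seq p)).seq <|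
    (loop b (q.seq ((copy (b + 3) (b + 2) (b + 4)).seq (inc (b + 1))))).seq <|
      copy (b + 2) b (b + 3), ?_⟩
  rintro σ v hv y hy
  set F : ℕ → ℕ := fun k => Nat.rec (f v.tail) (fun y IH => g (y ::ᵥ IH ::ᵥ v.tail)) k
  have hvt (i : Fin n) : v.tail.get i = σ (a i.succ) := by rw [List.Vector.get_tail_succ, hv]
  obtain ⟨σ₁, e₁, h₁, h₁'⟩ := exec_copy (r := a 0) (s := b) (t := b + 1)
    (by omega) (by omega) (by omega) σ
  obtain ⟨σ₂, e₂, h₂, h₂'⟩ := exec_clear (b + 1) σ₁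
  have low₂ (x : ℕ) (hx : x < b) : σ₂ x = σ x := by
    rw [h₂' x (by omega), h₁' x (by omega) (by omega)]
  obtain ⟨σ₃, e₃, h₃, h₃'⟩ := hp σ₂ v.tail
    (fun i => by rw [hvt, low₂ _ (ha _)]) _ rfl
  have hb : σ₃ b = v.head := by
    rw [h₃' b (by omega), h₂' b (by omega), h₁, ← hv, List.Vector.get_zero]
  obtain ⟨σ₄, e₄, -, ⟨h₄, h₅, low₄⟩⟩ := Exec.loop_invariant (r := b)
    (p := q.seq ((copy (b + 3) (b + 2) (b + 4)).seq (inc (b + 1))))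
    (fun k τ => τ (b + 1) + k = v.head ∧ τ (b + 2) = F (τ (b + 1)) ∧ ∀ x < b, τ x = σ x)
    (by
      rintro k τ hk ⟨i₁, i₂, low⟩
      obtain ⟨τ₁, d₁, j₁, j₁'⟩ := hq (update τ b k) (τ (b + 1) ::ᵥ τ (b + 2) ::ᵥ v.tail)
        (fun i => by
          refine Fin.cases ?_ (fun i => Fin.cases ?_ (fun i => ?_) i) i
          · simp
          · rw [List.Vector.get_cons_succ, List.Vector.get_cons_zero, Fin.cons_succ, Fin.cons_zero,
              update_of_ne (by omega)]
          · have := ha i.succ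
            simp only [List.Vector.get_cons_succ, Fin.cons_succ]
            rw [hvt, update_of_ne this.ne, low _ this]) _ rfl
      obtain ⟨τ₂, d₂, j₂, j₂'⟩ := exec_copy (r := b + 3) (s := b + 2) (t := b + 4)
        (by omega) (by omega) (by omega) τ₁
      have e : τ₂ (b + 1) = τ (b + 1) := by
        rw [j₂' _ (by omega) (by omega), j₁' _ (by omega), update_of_ne (by omega)]
      refine ⟨_, d₁.seq (d₂.seq (.inc _ _)), ?_, ?_, ?_, fun x hx => ?_⟩
      · rw [update_of_ne (by omega), j₂' _ (by omega) (by omega), j₁' _ (by omega), update_self]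
      · rw [update_self, e]; omega
      · rw [update_self, update_of_ne (by omega), j₂, j₁, i₂, e]
      · rw [update_of_ne (by omega), j₂' _ (by omega) (by omega), j₁' _ (by omega),
          update_of_ne (by omega), low x hx])
    v.head σ₃ hb
    ⟨by rw [h₃' _ (by omega), h₂, zero_add], by rw [h₃' (b + 1) (by omega), h₂, h₃]; rfl, fun x hx => by
      rw [h₃' x (by omega), low₂ x hx]⟩
  obtain ⟨σ₅, e₅, h₆, h₆'⟩ := exec_copy (r := b + 2) (s := b) (t := b + 3)
    (by omega) (by omega) (by omega) σ₄
  refine ⟨σ₅, .seq (.seq e₁ (.seq e₂ e₃)) (.seq e₄ e₅), ?_, fun x hx => ?_⟩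
  · rw [h₆, h₅, hy]
    rw [add_zero] at h₄
    rw [h₄]
  · rw [h₆' x (by omega) (by omega), low₄ x hx]

theorem Computes.rfind {n : ℕ} {f : List.Vector ℕ (n + 1) → ℕ}
    (hf : Computes fun v y => y = f v) :
    Computes fun (v : List.Vector ℕ n) y => f (y ::ᵥ v) = 0 ∧ ∀ k < y, f (k ::ᵥ v) ≠ 0 := by
  intro b a ha
  obtain ⟨p, hp⟩ := hf (b + 1) (Fin.cons b a) fun i => by
    refine Fin.cases ?_ (fun i => ?_) i
    · simp
    · have := ha i
      simp only [Fin.cons_succ]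
      omega
  refine ⟨((clear b).seq p).seq (loop (b + 1) ((inc b).seq p)), ?_⟩
  rintro σ v hv y ⟨hy, hlt⟩
  have hp' (τ : ℕ → ℕ) (hτ : ∀ x < b, τ x = σ x) :
      ∃ υ, Exec p τ υ ∧ υ b = τ b ∧ υ (b + 1) = f (τ b ::ᵥ v) ∧ ∀ x < b, υ x = σ x := by
    obtain ⟨υ, e, h, h'⟩ := hp τ (τ b ::ᵥ v)
      (fun i => Fin.cases (by simp) (fun i => by simp [hv, hτ _ (ha i)]) i) _ rfl
    exact ⟨υ, e, h' b (by omega), h, fun x hx => by rw [h' x (by omega), hτ x hx]⟩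
  -- Register `b` is the candidate and `b + 1` its value under `f`. The body overwrites the loop
  -- register, so `Exec.loop_invariant` does not apply; the induction is on the distance `k` to the
  -- least zero.
  have key (k : ℕ) : ∀ τ : ℕ → ℕ, τ b + k = y → τ (b + 1) = f (τ b ::ᵥ v) →
      (∀ x < b, τ x = σ x) → ∃ υ, Exec (loop (b + 1) ((inc b).seq p)) τ υ ∧ υ b = y ∧
        ∀ x < b, υ x = σ x := by
    induction k with
    | zero =>
      intro τ hk hτ hlow
      rw [add_zero] at hk
      exact ⟨τ, .loop_zero (by rw [hτ, hk, hy]), hk, hlow⟩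
    | succ k ih =>
      intro τ hk hτ hlow
      obtain ⟨l, hl⟩ := Nat.exists_eq_succ_of_ne_zero (hτ ▸ hlt (τ b) (by omega))
      set τ' := update τ (b + 1) l
      have hb : τ' b = τ b := update_of_ne (by omega) ..
      obtain ⟨υ, e, h, h', h''⟩ := hp' (update τ' b (τ' b + 1)) fun x hx => by
        rw [update_of_ne hx.ne, ← hlow x hx]; exact update_of_ne (by omega) ..
      rw [update_self, hb] at h h'
      obtain ⟨ω, e', g, g'⟩ := ih υ (by omega) (by rw [h', h]) h''
      exact ⟨ω, .loop_succ hl (.seq (.inc _ _) e) e', g, g'⟩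
  obtain ⟨σ₁, e₁, h₁, h₁'⟩ := exec_clear b σ
  obtain ⟨σ₂, e₂, h₂, h₂', h₂''⟩ := hp' σ₁ fun x hx => h₁' x hx.ne
  obtain ⟨σ₃, e₃, h₃, h₃'⟩ := key y σ₂ (by omega) (by rw [h₂', h₂]) h₂''
  exact ⟨σ₃, .seq (.seq e₁ e₂) e₃, h₃, h₃'⟩

theorem computes_of_primrec' {n : ℕ} {f : List.Vector ℕ n → ℕ} (hf : Nat.Primrec' f) :
    Computes fun v y => y = f v := by
  induction hf with
  | zero => exact computes_zero
  | succ => exact computes_succ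
  | get i => exact computes_get i
  | comp g _ _ ihf ihg =>
    refine (ihf.comp ihg).mono fun v y hy => ⟨_, fun i => ?_, hy⟩
    rw [List.Vector.get_ofFn]
  | prec _ _ ihf ihg => exact ihf.prec ihg

theorem mem_of_mem_mOfFn {α : Type*} {n : ℕ} {f : Fin n → Part α} {w : List.Vector α n}
    (hw : w ∈ List.Vector.mOfFn f) (i : Fin n) : w.get i ∈ f i := by
  induction n with
  | zero => exact i.elim0
  | succ n ih =>
    obtain ⟨x, hx, hw⟩ := Part.mem_bind_iff.1 hw
    obtain ⟨u, hu, hw⟩ := Part.mem_bind_iff.1 hw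
    obtain rfl := Part.mem_some_iff.1 hw
    refine Fin.cases ?_ (fun i => ?_) i
    · exact hx
    · rw [List.Vector.get_cons_succ]
      exact ih hu i

theorem computes_of_partrec' {n : ℕ} {f : List.Vector ℕ n →. ℕ} (hf : Nat.Partrec' f) :
    Computes fun v y => y ∈ f v := by
  induction hf with
  | prim hf => exact (computes_of_primrec' hf).mono fun v y hy => by simpa using hy
  | comp g _ _ ihf ihg =>
    refine (ihf.comp ihg).mono fun v y hy => ?_
    obtain ⟨w, hw, hy⟩ := Part.mem_bind_iff.1 hy
    exact ⟨w, mem_of_mem_mOfFn hw, hy⟩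
  | @rfind n f _ ihf =>
    refine (ihf.mono fun v y hy => ?_ : Computes fun v y => y = f v).rfind.mono fun v y hy => ?_
    · simp [hy]
    · obtain ⟨h, h'⟩ := Nat.mem_rfind.1 hy
      exact ⟨by simpa using h, fun k hk => by simpa using h' hk⟩

end Prog

/-! ### Compilation of programs to machines with two counters -/

namespace Instr

/-- Add `s` to all jump targets. -/
def shift {m : ℕ} (s : ℕ) : Instr m → Instr m
  | inc j k => inc j (s + k)
  | test j k l => test j (s + k) (s + l)

/-- All jump targets are at most `n`. -/
def TargetsLE (n : ℕ) {m : ℕ} : Instr m → Prop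
  | inc _ k => k ≤ n
  | test _ k l => k ≤ n ∧ l ≤ n

theorem shift_shift {m : ℕ} (s t : ℕ) (I : Instr m) : (I.shift t).shift s = I.shift (s + t) := by
  cases I <;> simp [shift, add_assoc]

theorem TargetsLE.mono {m n n' : ℕ} {I : Instr m} (h : I.TargetsLE n) (hn : n ≤ n') :
    I.TargetsLE n' := by
  cases I with
  | inc => exact le_trans h hn
  | test => exact ⟨h.1.trans hn, h.2.trans hn⟩

theorem TargetsLE.shift {m n : ℕ} {I : Instr m} (h : I.TargetsLE n) (s : ℕ) :
    (I.shift s).TargetsLE (s + n) := by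
  cases I with
  | inc => exact Nat.add_le_add_left h s
  | test => exact ⟨Nat.add_le_add_left h.1 s, Nat.add_le_add_left h.2 s⟩

/-- Code addresses start at `0` and machine labels at `1`; for whole-machine code the address just
after the code becomes `halt`. -/
theorem TargetsLE.targetsIn {m n : ℕ} {I : Instr m} (h : I.TargetsLE n) :
    (I.shift 1).TargetsIn (n + 1) := by
  cases I with
  | inc j k =>
    have h : k ≤ n := h
    exact ⟨by omega, by omega⟩
  | test j k l =>
    obtain ⟨h, h'⟩ : k ≤ n ∧ l ≤ n := h
    exact ⟨⟨by omega, by omega⟩, by omega, by omega⟩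

end Instr

/-! ### Determinism of machines, and placement of relocatable code -/

namespace CounterMachine

theorem step_rightUnique {m : ℕ} (M : CounterMachine m) : Relator.RightUnique M.Step := by
  intro x y z hy hz
  cases hy with
  | inc hI =>
    cases hz with
    | inc hJ => cases hI.unique hJ; rfl
    | zero hJ => cases hI.unique hJ
    | dec hJ => cases hI.unique hJ
  | zero hI h0 =>
    cases hz with
    | inc hJ => cases hI.unique hJ
    | zero hJ => cases hI.unique hJ; rfl
    | dec hJ h1 => cases hI.unique hJ; exact absurd h0 h1
  | dec hI h0 =>
    cases hz with
    | inc hJ => cases hI.unique hJ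
    | zero hJ h1 => cases hI.unique hJ; exact absurd h1 h0
    | dec hJ => cases hI.unique hJ; rfl

/-- The machine gets from `x` to `y`. -/
abbrev Runs {m : ℕ} (M : CounterMachine m) : ℕ × (Fin m → ℕ) → ℕ × (Fin m → ℕ) → Prop :=
  Relation.ReflTransGen M.Step

theorem not_step_size {m : ℕ} (M : CounterMachine m) (c : Fin m → ℕ) (y : ℕ × (Fin m → ℕ)) :
    ¬ M.Step (M.size, c) y := by
  intro h
  cases h with
  | inc hI => exact M.not_instrAt_size _ hI
  | zero hI => exact M.not_instrAt_size _ hI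
  | dec hI => exact M.not_instrAt_size _ hI

/-- Runs of a deterministic machine are comparable. From `s` the label never changes, and from
`halt` there is no step, so one run cannot reach both. -/
theorem not_halts_of_runs_spin {m : ℕ} {M : CounterMachine m} {s : ℕ} {j : Fin m}
    {c : Fin m → ℕ} (hs : M.InstrAt s (.inc j s)) (h : M.Runs (1, fun _ => 0) (s, c)) :
    ¬ M.Halts := by
  have hne : s ≠ M.size := fun h => M.not_instrAt_size _ (h ▸ hs)
  rintro ⟨d, hd⟩
  rcases Relation.ReflTransGen.total_of_right_unique M.step_rightUnique h hd with h' | h'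
  · have key {y} (hy : M.Runs (s, c) y) : y.1 = s := by
      induction hy with
      | refl => rfl
      | @tail y z _ hyz ih =>
        obtain ⟨i, e⟩ := y
        obtain rfl : i = s := ih
        cases hyz with
        | inc hI => cases hI.unique hs; rfl
        | zero hI => cases hI.unique hs
        | dec hI => cases hI.unique hs
    exact hne (key h').symm
  · obtain h' | ⟨y, hy, -⟩ := h'.cases_head
    · exact hne (congrArg Prod.fst h').symm
    · exact M.not_step_size _ _ hy

/-- The machine `M` contains the code `L`, with addresses relative to `a`, from `a` on. -/
def CodeAt {m : ℕ} (M : CounterMachine m) (a : ℕ) (L : List (Instr m)) : Prop :=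
  ∀ i I, L[i]? = some I → M.InstrAt (a + i) (I.shift a)

end CounterMachine

/-- Consecutive code, with addresses relative to its beginning. -/
def link {m : ℕ} (L L' : List (Instr m)) : List (Instr m) := L ++ L'.map (Instr.shift L.length)

/-- All jumps stay in the code or go to the address after it. -/
def Closed {m : ℕ} (L : List (Instr m)) : Prop := ∀ I ∈ L, I.TargetsLE L.length

theorem length_link {m : ℕ} (L L' : List (Instr m)) :
    (link L L').length = L.length + L'.length := by simp [link]

theorem Closed.link {m : ℕ} {L L' : List (Instr m)} (h : Closed L) (h' : Closed L') :
    Closed (link L L') := by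
  intro I hI
  rw [length_link]
  rcases List.mem_append.1 hI with hI | hI
  · exact (h I hI).mono (Nat.le_add_right _ _)
  · obtain ⟨J, hJ, rfl⟩ := List.mem_map.1 hI
    exact (h' J hJ).shift _

namespace CounterMachine

variable {m : ℕ} {M : CounterMachine m} {a : ℕ} {L L' : List (Instr m)}

theorem CodeAt.left (h : M.CodeAt a (L ++ L')) : M.CodeAt a L := fun i I hI =>
  h i I (by rw [List.getElem?_append_left (List.getElem?_eq_some_iff.1 hI).1, hI])

theorem CodeAt.right (h : M.CodeAt a (link L L')) : M.CodeAt (a + L.length) L' := fun i I hI => by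
  have := h (L.length + i) (I.shift L.length) (by
    rw [link, List.getElem?_append_right (Nat.le_add_right _ _), Nat.add_sub_cancel_left,
      List.getElem?_map, hI]
    rfl)
  rwa [Instr.shift_shift, ← add_assoc] at this

theorem CodeAt.last {I : Instr m} (h : M.CodeAt a (L ++ [I])) :
    M.InstrAt (a + L.length) (I.shift a) := h _ _ (by simp)

theorem codeAt_map_shift (L : List (Instr m)) : CodeAt (L.map (Instr.shift 1)) 1 L :=
  fun i I hI => ⟨i, add_comm _ _, by rw [List.getElem?_map, hI]; rfl⟩

end CounterMachine

/-- Increment counter `j` by `k`. -/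
def incCode (j : Fin 2) (k : ℕ) : List (Instr 2) := (List.range k).map fun i => .inc j (i + 1)

/-- Set counter `j` to zero, and add `p` times its value to counter `j'`. -/
def transferCode (j j' : Fin 2) (p : ℕ) : List (Instr 2) :=
  .test j (p + 1) 1 :: (List.range p).map fun i => .inc j' (if i + 1 = p then 0 else i + 2)

/-- Divide counter `0` by `p`, and add the quotient to counter `1`. If the remainder `i` is
nonzero, go to address `e - i`. -/
def divCode (p e : ℕ) : List (Instr 2) :=
  ((List.range p).map fun i => .test 0 (if i = 0 then p + 1 else e - i) (i + 1)) ++ [.inc 1 0]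

/-- Multiply counter `0` by `p`. -/
def mulCode (p : ℕ) : List (Instr 2) := link (transferCode 0 1 p) (transferCode 1 0 1)

/-- The first part of `loopCode`. -/
def loopHead (p : ℕ) (B : List (Instr 2)) : List (Instr 2) :=
  link (link (divCode p (2 * p + 3 + B.length)) (transferCode 1 0 1)) B

/-- While counter `0` is divisible by `p`, divide it by `p` and run `B`. -/
def loopCode (p : ℕ) (B : List (Instr 2)) : List (Instr 2) :=
  link (link (loopHead p B ++ [.test 1 0 0]) (incCode 0 (p - 1))) (transferCode 1 0 p)

theorem length_incCode (j : Fin 2) (k : ℕ) : (incCode j k).length = k := by simp [incCode]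

theorem length_transferCode (j j' : Fin 2) (p : ℕ) : (transferCode j j' p).length = p + 1 := by
  simp [transferCode]

theorem length_divCode (p e : ℕ) : (divCode p e).length = p + 1 := by simp [divCode]

theorem length_loopHead (p : ℕ) (B : List (Instr 2)) :
    (loopHead p B).length = p + 3 + B.length := by
  simp only [loopHead, length_link, length_divCode, length_transferCode]

theorem length_loopCode {p : ℕ} (hp : 0 < p) (B : List (Instr 2)) :
    (loopCode p B).length = 3 * p + 4 + B.length := by
  simp only [loopCode, length_link, length_loopHead, length_transferCode, List.length_append,
    List.length_singleton, length_incCode]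
  omega

theorem closed_incCode (j : Fin 2) (k : ℕ) : Closed (incCode j k) := by
  intro I hI
  rw [length_incCode]
  obtain ⟨i, hi, rfl⟩ := List.mem_map.1 hI
  exact List.mem_range.1 hi

theorem closed_transferCode (j j' : Fin 2) {p : ℕ} : Closed (transferCode j j' p) := by
  intro I hI
  rw [length_transferCode]
  rcases List.mem_cons.1 hI with rfl | hI
  · exact ⟨le_rfl, Nat.le_add_left _ _⟩
  · obtain ⟨i, hi, rfl⟩ := List.mem_map.1 hI
    have := List.mem_range.1 hi
    simp only [Instr.TargetsLE]
    split_ifs <;> omega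

theorem closed_mulCode (p : ℕ) : Closed (mulCode p) :=
  (closed_transferCode _ _).link (closed_transferCode _ _)

theorem closed_loopCode {p : ℕ} (hp : 0 < p) {B : List (Instr 2)} (hB : Closed B) :
    Closed (loopCode p B) := by
  -- The head is not closed by itself: nonzero remainders jump beyond it. Its targets are therefore
  -- bounded by the length of the whole loop.
  have h₁ (I) (hI : I ∈ loopHead p B) : I.TargetsLE (3 * p + 4 + B.length) := by
    rcases List.mem_append.1 hI with hI | hI
    · rcases List.mem_append.1 hI with hI | hI
      · rcases List.mem_append.1 hI with hI | hI
        · obtain ⟨i, hi, rfl⟩ := List.mem_map.1 hI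
          have := List.mem_range.1 hi
          simp only [Instr.TargetsLE]
          split_ifs <;> omega
        · obtain rfl := List.mem_singleton.1 hI
          exact Nat.zero_le _
      · obtain ⟨J, hJ, rfl⟩ := List.mem_map.1 hI
        refine ((closed_transferCode 1 0 J hJ).shift _).mono ?_
        rw [length_divCode, length_transferCode]
        omega
    · obtain ⟨J, hJ, rfl⟩ := List.mem_map.1 hI
      refine ((hB J hJ).shift _).mono ?_
      rw [length_link, length_divCode, length_transferCode]
      omega
  intro I hI
  rw [length_loopCode hp]
  rcases List.mem_append.1 hI with hI | hI
  · rcases List.mem_append.1 hI with hI | hI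
    · rcases List.mem_append.1 hI with hI | hI
      · exact h₁ I hI
      · obtain rfl := List.mem_singleton.1 hI
        exact ⟨Nat.zero_le _, Nat.zero_le _⟩
    · obtain ⟨J, hJ, rfl⟩ := List.mem_map.1 hI
      refine ((closed_incCode 0 (p - 1) J hJ).shift _).mono ?_
      rw [length_incCode, List.length_append, length_loopHead, List.length_singleton]
      omega
  · obtain ⟨J, hJ, rfl⟩ := List.mem_map.1 hI
    refine ((closed_transferCode 1 0 J hJ).shift _).mono (le_of_eq ?_)
    rw [← length_link, ← loopCode, length_loopCode hp]

/-! ### Runs of the code blocks -/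

namespace CounterMachine

open Relation.ReflTransGen (refl head single)

variable {M : CounterMachine 2} {a : ℕ}

/-- The values at the two counters determine the configuration, so the successor may be given in any
form, such as a vector literal. -/
theorem Runs.head_inc {i k : ℕ} {j j' : Fin 2} (hj : j ≠ j') {c d : Fin 2 → ℕ}
    {y : ℕ × (Fin 2 → ℕ)} (hI : M.InstrAt i (.inc j k)) (h : d j = c j + 1) (h' : d j' = c j')
    (hy : M.Runs (k, d) y) : M.Runs (i, c) y := by
  refine .head (.inc hI) ?_
  convert hy
  ext x
  by_cases hx : x = j
  · rw [hx, Function.update_self, h]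
  · rw [show x = j' by omega, Function.update_of_ne hj.symm, h']

theorem Runs.head_dec {i k l : ℕ} {j j' : Fin 2} (hj : j ≠ j') {c d : Fin 2 → ℕ}
    {y : ℕ × (Fin 2 → ℕ)} (hI : M.InstrAt i (.test j k l)) (h : c j = d j + 1) (h' : d j' = c j')
    (hy : M.Runs (l, d) y) : M.Runs (i, c) y := by
  refine .head (.dec hI (by omega)) ?_
  convert hy
  ext x
  by_cases hx : x = j
  · rw [hx, Function.update_self]; omega
  · rw [show x = j' by omega, Function.update_of_ne hj.symm, h']

/-- Entry at an arbitrary address `i` is allowed: a division restores its remainder by entering this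
block late. -/
theorem CodeAt.runs_incCode {k : ℕ} (h : M.CodeAt a (incCode 0 k)) (n : ℕ) :
    ∀ i, i + n = k → ∀ x y, M.Runs (a + i, ![x, y]) (a + k, ![x + n, y]) := by
  induction n with
  | zero => rintro i rfl x y; exact .refl
  | succ n ih =>
    intro i hi x y
    have hI := h i (.inc 0 (i + 1)) (by
      rw [incCode, List.getElem?_map, List.getElem?_range (by omega)]; rfl)
    refine Runs.head_inc (j' := 1) (by decide) hI (d := ![x + 1, y]) rfl rfl ?_
    have := ih (i + 1) (by omega) (x + 1) y
    rwa [add_right_comm x 1 n, add_assoc x n 1] at this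

theorem CodeAt.runs_transferCode_inc {j j' : Fin 2} (hj : j ≠ j') {p : ℕ}
    (h : M.CodeAt a (transferCode j j' p)) (n : ℕ) :
    ∀ i, i + n + 1 = p → ∀ c d : Fin 2 → ℕ, d j = c j → d j' = c j' + (n + 1) →
      M.Runs (a + (i + 1), c) (a, d) := by
  induction n with
  | zero =>
    rintro i rfl c d h₁ h₂
    have hI := h (i + 1) (.inc j' 0) (by simp [transferCode])
    exact Runs.head_inc hj.symm hI h₂ h₁ .refl
  | succ n ih =>
    rintro i hi c d h₁ h₂
    have hI := h (i + 1) (.inc j' (i + 2)) (by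
      rw [transferCode, List.getElem?_cons_succ, List.getElem?_map, List.getElem?_range (by omega)]
      simp; omega)
    refine Runs.head_inc hj.symm hI (d := Function.update c j' (c j' + 1))
      (Function.update_self ..) (Function.update_of_ne hj ..) ?_
    refine ih (i + 1) (by omega) _ _ ?_ ?_
    · rw [Function.update_of_ne hj, h₁]
    · rw [Function.update_self, h₂]; omega

theorem CodeAt.runs_transferCode {j j' : Fin 2} (hj : j ≠ j') {p : ℕ} (hp : 0 < p)
    (h : M.CodeAt a (transferCode j j' p)) (n : ℕ) :
    ∀ c d : Fin 2 → ℕ, c j = n → d j = 0 → d j' = c j' + p * n →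
      M.Runs (a, c) (a + (p + 1), d) := by
  have hI := h 0 (.test j (p + 1) 1) rfl
  induction n with
  | zero =>
    intro c d h₁ h₂ h₃
    obtain rfl : c = d := by
      ext x
      by_cases hx : x = j
      · rw [hx, h₁, h₂]
      · rw [show x = j' by omega, h₃, mul_zero, add_zero]
    exact .single (.zero hI h₁)
  | succ n ih =>
    intro c d h₁ h₂ h₃
    refine Runs.head_dec hj hI (d := Function.update c j n) ?_ (Function.update_of_ne hj.symm ..) ?_
    · rw [h₁, Function.update_self]
    · obtain ⟨q, rfl⟩ := Nat.exists_eq_add_of_le' hp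
      set e : Fin 2 → ℕ := Function.update (Function.update c j n) j' (c j' + (q + 1)) with he
      have e₁ : e j = n := by rw [he, Function.update_of_ne hj, Function.update_self]
      have e₂ : e j' = c j' + (q + 1) := by rw [he, Function.update_self]
      refine (h.runs_transferCode_inc hj q 0 (by omega) _ e ?_ ?_).trans (ih e d e₁ h₂ ?_)
      · rw [e₁, Function.update_self]
      · rw [e₂, Function.update_of_ne hj.symm]
      · rw [h₃, e₂]; ring

theorem CodeAt.runs_mulCode {p : ℕ} (hp : 0 < p) (h : M.CodeAt a (mulCode p)) (x : ℕ) :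
    M.Runs (a, ![x, 0]) (a + (mulCode p).length, ![p * x, 0]) := by
  have h₁ := h.left.runs_transferCode (by decide) hp x ![x, 0] ![0, p * x] rfl rfl (by simp)
  have h₂ := h.right.runs_transferCode (by decide) one_pos (p * x) ![0, p * x] ![p * x, 0]
    rfl rfl (by simp)
  rw [length_transferCode] at h₂
  rw [mulCode, length_link, length_transferCode, length_transferCode, ← add_assoc a]
  exact h₁.trans h₂

theorem CodeAt.divCode_test {p e : ℕ} (h : M.CodeAt a (divCode p e)) {i : ℕ} (hi : i < p) :
    M.InstrAt (a + i) (.test 0 (a + if i = 0 then p + 1 else e - i) (a + (i + 1))) := by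
  refine h i (.test 0 (if i = 0 then p + 1 else e - i) (i + 1)) ?_
  rw [divCode, List.getElem?_append_left (by simpa using hi), List.getElem?_map,
    List.getElem?_range hi]
  rfl

theorem CodeAt.runs_divCode_dec {p e : ℕ} (h : M.CodeAt a (divCode p e)) (n : ℕ) :
    ∀ i, i + n ≤ p → ∀ x y, M.Runs (a + i, ![x + n, y]) (a + (i + n), ![x, y]) := by
  induction n with
  | zero => intro i hi x y; exact .refl
  | succ n ih =>
    intro i hi x y
    refine Runs.head_dec (j' := 1) (by decide) (h.divCode_test (by omega)) (d := ![x + n, y])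
      rfl rfl ?_
    have := ih (i + 1) (by omega) x y
    rwa [add_right_comm i 1 n] at this

/-- Each full pass takes `p` from counter `0` and adds one to counter `1`. In the final partial pass
the address at which counter `0` is found empty is the remainder. -/
theorem CodeAt.runs_divCode {p e : ℕ} (h : M.CodeAt a (divCode p e)) {r : ℕ} (hr : r < p)
    (q : ℕ) : ∀ y, M.Runs (a, ![p * q + r, y])
      (a + if r = 0 then p + 1 else e - r, ![0, y + q]) := by
  induction q with
  | zero =>
    intro y
    have h₁ := h.runs_divCode_dec r 0 (by omega) 0 y
    rw [zero_add, add_zero] at h₁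
    rw [mul_zero, zero_add]
    exact h₁.tail (.zero (h.divCode_test hr) rfl)
  | succ q ih =>
    intro y
    have h₁ := h.runs_divCode_dec p 0 (by omega) (p * q + r) y
    have hI : M.InstrAt (a + p) (.inc 1 a) := h p (.inc 1 0) (by simp [divCode])
    have h₂ := Runs.head_inc (j' := 0) (by decide) hI (c := ![p * q + r, y])
      (d := ![p * q + r, y + 1]) rfl rfl (ih (y + 1))
    rw [zero_add, add_zero] at h₁
    rw [add_assoc y 1 q, add_comm 1 q] at h₂
    rw [show p * (q + 1) + r = p * q + r + p by ring]
    exact h₁.trans h₂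

theorem CodeAt.loopCode_body {p : ℕ} {B : List (Instr 2)} (h : M.CodeAt a (loopCode p B)) :
    M.CodeAt (a + (p + 3)) B := by
  have := h.left.left.left.right
  rwa [length_link, length_divCode, length_transferCode] at this

theorem CodeAt.runs_loopCode_of_dvd {p : ℕ} (hp : 0 < p) {B : List (Instr 2)}
    (h : M.CodeAt a (loopCode p B)) (x : ℕ) :
    M.Runs (a, ![p * x, 0]) (a + (p + 3), ![x, 0]) := by
  have h₁ := h.left.left.left.left.left.runs_divCode hp x 0
  have h₂ := h.left.left.left.left.right.runs_transferCode (by decide) one_pos x ![0, x] ![x, 0]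
    rfl rfl (by simp)
  rw [length_divCode] at h₂
  rw [if_pos rfl, add_zero, zero_add] at h₁
  exact h₁.trans h₂

/-- The failed division is undone. Its exit enters the block of `p - 1` increments exactly `x % p`
instructions before the end, which restores the remainder; then `p` times the quotient is added
back. -/
theorem CodeAt.runs_loopCode_of_not_dvd {p : ℕ} (hp : 0 < p) {B : List (Instr 2)}
    (h : M.CodeAt a (loopCode p B)) {x : ℕ} (hx : ¬ p ∣ x) :
    M.Runs (a, ![x, 0]) (a + (loopCode p B).length, ![x, 0]) := by
  have hr : x % p ≠ 0 := fun h => hx (Nat.dvd_of_mod_eq_zero h)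
  have hlt := Nat.mod_lt x hp
  have h₁ := h.left.left.left.left.left.runs_divCode hlt (x / p) 0
  have h₂ := h.left.right.runs_incCode (x % p) (p - 1 - x % p) (by omega) 0 (x / p)
  have h₃ := h.right.runs_transferCode (by decide) hp (x / p) ![x % p, x / p] ![x, 0] rfl rfl
    (Nat.mod_add_div x p).symm
  rw [length_link, List.length_append, length_loopHead, List.length_singleton, length_incCode] at h₃
  rw [List.length_append, length_loopHead, List.length_singleton, zero_add] at h₂
  rw [if_neg hr, Nat.div_add_mod, zero_add] at h₁
  rw [length_loopCode hp]
  convert (h₁.trans ?_).trans h₃ using 2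
  · omega
  · convert h₂ using 2 <;> omega

/-- As counter `1` is empty, the test acts as an unconditional jump; it is appended without
relocation, so its target is the beginning of the loop. -/
theorem CodeAt.runs_loopCode_jump {p : ℕ} {B : List (Instr 2)}
    (h : M.CodeAt a (loopCode p B)) (x : ℕ) :
    M.Runs (a + (p + 3) + B.length, ![x, 0]) (a, ![x, 0]) := by
  have hI := h.left.left.last
  rw [length_loopHead, ← add_assoc a (p + 3)] at hI
  exact .single (.zero hI rfl)

end CounterMachine

/-! ### Registers as prime exponents -/

namespace Prog

/-- The prime number whose exponent is the contents of register `r`. -/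
noncomputable def regPrime (r : ℕ) : ℕ := Nat.nth Nat.Prime r

theorem prime_regPrime (r : ℕ) : (regPrime r).Prime := Nat.prime_nth_prime r

theorem regPrime_injective : Function.Injective regPrime :=
  Nat.nth_injective Nat.infinite_setOfPred_prime

/-- `N` is the number that represents the register contents `σ`. -/
def Represents (N : ℕ) (σ : ℕ → ℕ) : Prop := N ≠ 0 ∧ ∀ r, N.factorization (regPrime r) = σ r

theorem Represents.dvd_iff {N r : ℕ} {σ : ℕ → ℕ} (h : Represents N σ) :
    regPrime r ∣ N ↔ σ r ≠ 0 := by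
  rw [← h.2 r, (prime_regPrime r).dvd_iff_one_le_factorization h.1, Nat.one_le_iff_ne_zero]

theorem Represents.mul {N r : ℕ} {σ : ℕ → ℕ} (h : Represents N σ) :
    Represents (regPrime r * N) (Function.update σ r (σ r + 1)) := by
  refine ⟨mul_ne_zero (prime_regPrime r).ne_zero h.1, fun s => ?_⟩
  rw [Nat.factorization_mul (prime_regPrime r).ne_zero h.1, (prime_regPrime r).factorization,
    Finsupp.add_apply, h.2]
  obtain rfl | hs := eq_or_ne s r
  · rw [Finsupp.single_eq_same, Function.update_self, add_comm]
  · rw [Finsupp.single_eq_of_ne (regPrime_injective.ne hs), Function.update_of_ne hs, zero_add]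

theorem Represents.exists_mul {N r k : ℕ} {σ : ℕ → ℕ} (h : Represents N σ) (hk : σ r = k + 1) :
    ∃ N', N = regPrime r * N' ∧ Represents N' (Function.update σ r k) := by
  obtain ⟨N', rfl⟩ := (h.dvd_iff (r := r)).2 (by omega)
  have h₀ := right_ne_zero_of_mul h.1
  refine ⟨N', rfl, h₀, fun s => ?_⟩
  have hs := h.2 s
  rw [Nat.factorization_mul (prime_regPrime r).ne_zero h₀, (prime_regPrime r).factorization,
    Finsupp.add_apply] at hs
  obtain rfl | hsr := eq_or_ne s r
  · rw [Finsupp.single_eq_same, hk] at hs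
    rw [Function.update_self]
    omega
  · rwa [Finsupp.single_eq_of_ne (regPrime_injective.ne hsr), zero_add,
      ← Function.update_of_ne hsr k σ] at hs

/-- The code of a program for a machine with two counters, of which the first one
represents the registers. -/
noncomputable def compile : Prog → List (Instr 2)
  | skip => []
  | inc r => mulCode (regPrime r)
  | seq p q => link (compile p) (compile q)
  | loop r p => loopCode (regPrime r) (compile p)

theorem closed_compile (p : Prog) : Closed p.compile := by
  induction p with
  | skip => intro I hI; cases hI
  | inc r => exact closed_mulCode _
  | seq p q ihp ihq => exact ihp.link ihq
  | loop r p ih => exact closed_loopCode (prime_regPrime r).pos ih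

/-- Incrementing a register multiplies by its prime, testing it is a divisibility test, and
decrementing it divides. Between these operations counter `1` is always empty. -/
theorem Exec.runs_compile {M : CounterMachine 2} {p : Prog} {σ τ : ℕ → ℕ} (h : Exec p σ τ) :
    ∀ a, M.CodeAt a p.compile → ∀ N, Represents N σ → ∃ N', Represents N' τ ∧
      M.Runs (a, ![N, 0]) (a + p.compile.length, ![N', 0]) := by
  induction h with
  | skip σ => exact fun a _ N hN => ⟨N, hN, .refl⟩
  | inc r σ => exact fun a ha N hN => ⟨_, hN.mul, ha.runs_mulCode (prime_regPrime r).pos N⟩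
  | seq _ _ ih₁ ih₂ =>
    intro a ha N hN
    obtain ⟨N₁, hN₁, h₁⟩ := ih₁ a ha.left N hN
    obtain ⟨N₂, hN₂, h₂⟩ := ih₂ _ ha.right N₁ hN₁
    refine ⟨N₂, hN₂, ?_⟩
    rw [compile, length_link, ← add_assoc]
    exact h₁.trans h₂
  | @loop_zero r p σ hr =>
    intro a ha N hN
    exact ⟨N, hN, ha.runs_loopCode_of_not_dvd (prime_regPrime r).pos
      fun h => hN.dvd_iff.1 h hr⟩
  | @loop_succ r p σ τ υ k hr _ _ ih₁ ih₂ =>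
    intro a ha N hN
    obtain ⟨N₀, rfl, hN₀⟩ := hN.exists_mul hr
    obtain ⟨N₁, hN₁, h₁⟩ := ih₁ _ ha.loopCode_body N₀ hN₀
    obtain ⟨N₂, hN₂, h₂⟩ := ih₂ a ha N₁ hN₁
    exact ⟨N₂, hN₂, (ha.runs_loopCode_of_dvd (prime_regPrime r).pos N₀).trans
      (h₁.trans ((ha.runs_loopCode_jump N₁).trans h₂))⟩

end Prog

/-! ### Undecidability -/

theorem primrec_shift : Primrec₂ (Instr.shift (m := 2)) := by
  have hinc : Primrec fun x : Fin 2 × ℕ => Instr.inc x.1 x.2 :=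
    (Primrec.of_equiv_symm (e := Instr.equivSum 2)).comp Primrec.sumInl
  have htest : Primrec fun x : Fin 2 × ℕ × ℕ => Instr.test x.1 x.2.1 x.2.2 :=
    (Primrec.of_equiv_symm (e := Instr.equivSum 2)).comp Primrec.sumInr
  have h₁ : Primrec₂ fun (x : ℕ × Instr 2) (y : Fin 2 × ℕ) => Instr.inc y.1 (x.1 + y.2) :=
    hinc.comp (Primrec.pair (Primrec.fst.comp .snd)
      (Primrec.nat_add.comp (Primrec.fst.comp .fst) (Primrec.snd.comp .snd)))
  have h₂ : Primrec₂ fun (x : ℕ × Instr 2) (y : Fin 2 × ℕ × ℕ) =>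
      Instr.test y.1 (x.1 + y.2.1) (x.1 + y.2.2) :=
    htest.comp (Primrec.pair (Primrec.fst.comp .snd) (Primrec.pair
      (Primrec.nat_add.comp (Primrec.fst.comp .fst) (Primrec.fst.comp (Primrec.snd.comp .snd)))
      (Primrec.nat_add.comp (Primrec.fst.comp .fst) (Primrec.snd.comp (Primrec.snd.comp .snd)))))
  refine (Primrec.sumCasesOn ((Primrec.of_equiv (e := Instr.equivSum 2)).comp .snd) h₁ h₂).of_eq
    fun x => ?_
  obtain ⟨s, I⟩ := x
  cases I <;> rfl

theorem primrec_incCode (j : Fin 2) : Primrec (incCode j) := by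
  have hinc : Primrec fun k : ℕ => Instr.inc j k :=
    (Primrec.of_equiv_symm (e := Instr.equivSum 2)).comp
      (Primrec.sumInl.comp (Primrec.pair (Primrec.const j) .id))
  exact Primrec.list_map Primrec.list_range (hinc.comp (Primrec.succ.comp .snd))

theorem primrec_link : Primrec₂ (link (m := 2)) :=
  Primrec.list_append.comp₂ .left <| Primrec.list_map .snd <|
    primrec_shift.comp (Primrec.list_length.comp (Primrec.fst.comp .fst)) .snd

/-- The machine that puts `x` into its first counter and then runs the code `L`. -/
def loadMachine (x : ℕ) (L : List (Instr 2)) : CounterMachine 2 :=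
  (link (incCode 0 x) L).map (Instr.shift 1)

theorem primrec_loadMachine : Primrec₂ loadMachine :=
  Primrec.list_map (primrec_link.comp ((primrec_incCode 0).comp .fst) .snd)
    (primrec_shift.comp (Primrec.const 1) .snd)

theorem loadMachine_wellFormed (x : ℕ) {L : List (Instr 2)} (hL : Closed L) :
    (loadMachine x L).WellFormed := by
  intro I hI
  obtain ⟨J, hJ, rfl⟩ := List.mem_map.1 hI
  rw [CounterMachine.size, loadMachine, List.length_map]
  exact (((closed_incCode 0 x).link hL) J hJ).targetsIn

theorem loadMachine_size (x : ℕ) (L : List (Instr 2)) :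
    (loadMachine x L).size = 1 + x + L.length := by
  rw [CounterMachine.size, loadMachine, List.length_map, length_link, length_incCode]
  omega

theorem loadMachine_codeAt (x : ℕ) (L : List (Instr 2)) :
    (loadMachine x L).CodeAt (1 + x) L := by
  have := (CounterMachine.codeAt_map_shift (link (incCode 0 x) L)).right
  rwa [length_incCode] at this

theorem loadMachine_runs (x : ℕ) (L : List (Instr 2)) :
    (loadMachine x L).Runs (1, fun _ => 0) (1 + x, ![x, 0]) := by
  have h : (loadMachine x L).CodeAt 1 (incCode 0 x) :=
    (CounterMachine.codeAt_map_shift (link (incCode 0 x) L)).left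
  have := h.runs_incCode x 0 (zero_add x) 0 0
  rw [zero_add, add_zero] at this
  convert this using 2
  ext i
  fin_cases i <;> rfl

/-- Run `p`, and then loop forever if register `1` is nonzero. -/
noncomputable def Prog.testCode (p : Prog) : List (Instr 2) :=
  link p.compile (loopCode (regPrime 1) [.inc 0 0])

theorem Prog.closed_testCode (p : Prog) : Closed p.testCode := by
  refine p.closed_compile.link (closed_loopCode (prime_regPrime 1).pos fun I hI => ?_)
  obtain rfl := List.mem_singleton.1 hI
  exact Nat.zero_le _

/-- The code after `p` tests divisibility by the prime of register `1`: if it divides, control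
enters an instruction that jumps to itself, and otherwise control falls through to `halt`. -/
theorem Prog.Exec.halts_iff {p : Prog} {σ τ : ℕ → ℕ} (h : p.Exec σ τ) {N : ℕ}
    (hN : Prog.Represents N σ) : (loadMachine N p.testCode).Halts ↔ τ 1 = 0 := by
  have hcode := loadMachine_codeAt N p.testCode
  obtain ⟨N', hN', hrun⟩ := h.runs_compile _ hcode.left N hN
  replace hrun := (loadMachine_runs N p.testCode).trans hrun
  have hpos := (Prog.prime_regPrime 1).pos
  by_cases h₁ : τ 1 = 0
  · refine iff_of_true ⟨![N', 0], ?_⟩ h₁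
    rw [loadMachine_size, Prog.testCode, length_link, ← add_assoc]
    exact hrun.trans (hcode.right.runs_loopCode_of_not_dvd hpos fun hd => hN'.dvd_iff.1 hd h₁)
  · refine iff_of_false ?_ h₁
    obtain ⟨x, rfl⟩ := hN'.dvd_iff.2 h₁
    exact CounterMachine.not_halts_of_runs_spin (hcode.right.loopCode_body 0 (.inc 0 0) rfl)
      (hrun.trans (hcode.right.runs_loopCode_of_dvd hpos x))

theorem Prog.represents_two_pow (n : ℕ) :
    Prog.Represents (2 ^ n) (Function.update (fun _ => 0) 0 n) := by
  have h₀ : Prog.regPrime 0 = 2 := Nat.nth_prime_zero_eq_two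
  refine ⟨by positivity, fun r => ?_⟩
  rw [Nat.prime_two.factorization_pow, ← h₀]
  obtain rfl | hr := eq_or_ne r 0
  · rw [Finsupp.single_eq_same, Function.update_self]
  · rw [Finsupp.single_eq_of_ne (Prog.regPrime_injective.ne hr), Function.update_of_ne hr]

/-- Whether a partial recursive function vanishes can be expressed by the halting of machines
with two counters. -/
theorem exists_machine_halts_iff {f : ℕ →. ℕ} (hf : Partrec f) :
    ∃ M : ℕ → CounterMachine 2, Primrec M ∧ (∀ n, (M n).WellFormed ∧ M n ≠ []) ∧
      ∀ n, ∀ y ∈ f n, (M n).Halts ↔ y = 0 := by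
  -- The argument is in register `0`, whose prime is `2`, and the result in register `1`, which
  -- `Prog.testCode` inspects.
  obtain ⟨p, hp⟩ := Prog.computes_of_partrec' (Nat.Partrec'.part_iff₁.2 hf) 1 (fun _ => 0)
    fun _ => one_pos
  have hpow : Primrec fun n : ℕ => 2 ^ n :=
    (Primrec₂.unpaired'.1 Nat.Primrec.pow).comp (Primrec.const 2) .id
  -- The code is one fixed list and only the loaded number depends on `n`, so the compiler itself
  -- need not be computable.
  refine ⟨fun n => loadMachine (2 ^ n) p.testCode,
    primrec_loadMachine.comp hpow (.const _),
    fun n => ⟨loadMachine_wellFormed _ p.closed_testCode, fun h => ?_⟩, fun n y hy => ?_⟩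
  · have := congrArg CounterMachine.size h
    rw [loadMachine_size] at this
    have h₂ : 0 < 2 ^ n := by positivity
    simp only [CounterMachine.size, List.length_nil] at this
    omega
  · obtain ⟨τ, hτ, h₁, -⟩ := hp (Function.update (fun _ => 0) 0 n) (n ::ᵥ .nil)
      (fun i => by rw [Subsingleton.elim i 0, List.Vector.get_cons_zero, Function.update_self]) y hy
    rw [hτ.halts_iff (Prog.represents_two_pow n), h₁]

/-- No algorithm decides whether a well-formed machine with two counters halts. -/
theorem not_exists_partrec_not_halts :
    ¬ ∃ g : CounterMachine 2 →. Bool, Partrec g ∧ ∀ M : CounterMachine 2, M.WellFormed → M ≠ [] →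
      ∃ b ∈ g M, (b = true ↔ ¬ M.Halts) := by
  rintro ⟨g, hg, hgM⟩
  have hf : Partrec fun n : ℕ => (Denumerable.ofNat Nat.Partrec.Code n).eval n :=
    Nat.Partrec.Code.eval_part.comp (Computable.ofNat _) Computable.id
  obtain ⟨M, hM, hM', hf⟩ := exists_machine_halts_iff hf
  -- The diagonal function returns `0` where non-halting is claimed and `1` where halting is
  -- claimed. At its own code number, its value is `0` exactly when the machine halts, so the claim
  -- is wrong there.
  have hd : Partrec fun n => (g (M n)).map fun b => cond b 0 1 :=
    (hg.comp hM.to_comp).map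
      (Computable.cond Computable.snd (Computable.const 0) (Computable.const 1)).to₂
  obtain ⟨d, hd⟩ := Nat.Partrec.Code.exists_code.1 (Partrec.nat_iff.1 hd)
  obtain ⟨b, hb, hb'⟩ := hgM (M (Encodable.encode d)) (hM' _).1 (hM' _).2
  have := hf (Encodable.encode d) (cond b 0 1) (by
    rw [Denumerable.ofNat_encode, hd]
    exact Part.mem_map _ hb)
  cases b <;> simp_all

end ProcRewrite

open ProcRewrite in
theorem mainTheorem3 :
    -- simulation preorder between PA processes and FS processes is undecidable
    (¬ ∃ g : PRS × Expr × PRS × Expr →. Bool, Partrec g ∧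
      ∀ (Δ₁ : PRS) (E : Expr) (Δ₂ : PRS) (F : Expr), Δ₁.IsPA → Δ₂.IsFS →
        ∀ (hE : Proc.mk E ∈ Δ₁.states Set.univ)
          (hF : Proc.mk F ∈ Δ₂.states PRS.constants),
          ∃ b ∈ g (Δ₁, E, Δ₂, F),
            (b = true ↔ LTS.Simulated Δ₁.paLTS Δ₂.fsLTS ⟨Proc.mk E, hE⟩ ⟨Proc.mk F, hF⟩)) ∧
    -- the construction for two-counter machines is effective and correct
    Computable controlFS ∧
    counterPA.IsPA ∧
    ∃ hZ : Proc.mk zeroCounters ∈ counterPA.states Set.univ,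
      counterPA.paLTS.DeterministicFrom ⟨Proc.mk zeroCounters, hZ⟩ ∧
      ∀ M : CounterMachine 2, M.WellFormed → M ≠ [] →
        (controlFS M).IsFS ∧
        ∃ hf : Proc.mk (constF 1) ∈ (controlFS M).states PRS.constants,
          (controlFS M).fsLTS.DeterministicFrom ⟨Proc.mk (constF 1), hf⟩ ∧
          (LTS.Simulated counterPA.paLTS (controlFS M).fsLTS
              ⟨Proc.mk zeroCounters, hZ⟩ ⟨Proc.mk (constF 1), hf⟩ ↔
            ¬ M.Halts) := by
  -- Two counters of value zero unfold to `Z_1 ‖ Z_2`, so the results on counter states apply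
  -- directly.
  refine ⟨?_, primrec_controlFS.to_comp, counterPA_isPA, counterProc_mem_states fun _ => 0,
    counterPA_deterministicFrom fun _ => 0, fun M hM hM' => ⟨controlFS_isFS M, constF_one_mem_states hM',
      controlFS_deterministicFrom M _, simulated_iff_not_halts hM _⟩⟩
  rintro ⟨g, hg, hgΔ⟩
  refine not_exists_partrec_not_halts
    ⟨fun M => g (counterPA, zeroCounters, controlFS M, constF 1), hg.comp ?_, fun M hM hM' => ?_⟩
  · exact (Computable.const counterPA).pair ((Computable.const zeroCounters).pair
      (primrec_controlFS.to_comp.pair (Computable.const (constF 1))))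
  · obtain ⟨b, hb, h⟩ := hgΔ counterPA zeroCounters (controlFS M) (constF 1) counterPA_isPA
      (controlFS_isFS M) (counterProc_mem_states fun _ => 0) (constF_one_mem_states hM')
    exact ⟨b, hb, h.trans (simulated_iff_not_halts hM _)⟩
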